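/- Conventions. Let $(\mathbb P,\le)$ be a poset and $\Theta\subseteq\mathcal P(\mathbb P)$. For a relation $\prec$ on a set and subsets $R,S$, write $R\prec S$ if every $r\in R$ satisfies $r\prec s$ for some $s\in S$. A set $S$ is *$\prec$-directed* if every finite $F\subseteq S$ has some $s\in S$ with $s\prec f$ for all $f\in F$, and a *$\prec$-filter* if a finite set $F$ is contained in $S$ exactly when there is $s\in S$ with $s\prec f$ for all $f\in F$. A family $\Theta$ is called *directed*, respectively a *filter*, if it is so for the refinement preorder $C\le D$ on $\mathcal P(\mathbb P)$. It is *countable* if it has a countable coinitial subfamily $\Theta_0\subseteq\Theta$ (every $C\in\Theta$ is refined by some $D\in\Theta_0$); this includes every $\Theta$ that is countable as a set. Let $\Theta^\le=\{D:\exists C\in\Theta\ (C\le D)\}$. A set $S\subseteq\mathbb P$ is *$\Theta$-Cauchy* if $C\cap S\ne\emptyset$ for all $C\in\Theta$; *$\Theta$-round* if for every $s\in S$ there is $C\in\Theta$ such that every element of $C\cap S$ is $\le s$; *$\Theta^\le$-near* if there is $D\notin\Theta^\le$ with $D\cup\{s\}\in\Theta^\le$ for all $s\in S$. The *spectrum*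 $\widehat\Theta$ is the set of $\Theta$-round $\Theta$-Cauchy up-sets $R\subseteq\mathbb P$, with the topology that has the sets $\widehat\Theta_p=\{R\in\widehat\Theta:p\in R\}$ ($p\in\mathbb P$) as a subbasis. Put $\dot{\mathbb P}=\{p:\{p\}\text{ is }\Theta^\le\text{-near}\}$, $Cp=\{c\in C:\{c,p\}\text{ is }\Theta^\le\text{-near}\}$, and let $p\vartriangleleft q$ mean that there is $C\in\Theta$ such that every $c\in Cp$ satisfies $c\le q$. $\Theta$ is *admissible* if every $p\in\mathbb P$ is the supremum of $\{q:q\vartriangleleft p\}$, and *star-regular* if for all $p\in\mathbb P$ and $C\in\Theta$ there is $D\in\Theta$ with $Dp\vartriangleleft C$. Let $C^{\vartriangleright}=\{p:\exists c\in C\ (p\vartriangleleft c)\}$. The *regularisation* is $\Theta^{\mathsf R}=\bigcup_{n\ge1}\Theta^n$, where $\Theta^1=\Theta$, $\Theta^{n+1}=\{C^{\vartriangleright}:C\in\Theta^n\}$, and $\vartriangleleft$ always refers to the original $\Theta$. Now let $X$ be a topological space and $\mathbb P\subseteq\mathcal O(X)$, ordered by inclusion, and $\Theta\subseteq\mathcal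 P(\mathbb P)$. Put $\mathbb P_x=\{p\in\mathbb P:x\in p\}$, $C_x=C\cap\mathbb P_x$, and $\mathcal C_X(\mathbb P)=\{C\subseteq\mathbb P:\bigcup C=X\}$. $\Theta$ is *compatible* if for every $x\in X$ the sets $\bigcup C_x$ ($C\in\Theta$) are a neighbourhood base at $x$; *locally uniform* if for all $x\in X$ and $C\in\Theta$ there is $D\in\Theta$ such that every $d\in D$ that meets $\bigcup D_x$ is contained in $\bigcup C_x$; *complete* if every $\Theta$-Cauchy $\vartriangleleft$-filter $R\subseteq\mathbb P$ contains $\mathbb P_x$ for some $x\in X$. **Theorem.** 1. If $\Theta$ is star-regular and directed, and $p\vartriangleleft q$ implies $p\le q$, then $$\widehat\Theta=\{R\subseteq\dot{\mathbb P}:R\text{ is a }\Theta\text{-Cauchy }\vartriangleleft\text{-filter}\},$$ and if $\Theta$ is also countable then $\widehat\Theta$ is completely metrisable. 2. If $\Theta$ is admissible and directed then so is $\Theta^{\mathsf R}$ (admissibility being with respect to the uniformly below relation of $\Theta^{\mathsf R}$), and $$\widehat{\Theta^{\mathsf R}}=\{R\subseteq\dot{\mathbb P}:R\text{ is a }\Theta\text{-Cauchy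 }\vartriangleleft\text{-filter}\},$$ where $\dot{\mathbb P}$ and $\vartriangleleft$ are those of $\Theta$. If $\Theta$ is also countable then $\widehat{\Theta^{\mathsf R}}$ is completely metrisable. 3. (Duality.) (a) Let $\Theta$ be a countable admissible filter on a poset $\mathbb P$. Then $X=\widehat{\Theta^{\mathsf R}}$ is completely metrisable with basis $\mathbb P'=\{\widehat{\Theta^{\mathsf R}}_p:p\in\mathbb P\}$; for all $p,q\in\mathbb P$, $p\le q$ if and only if $\widehat{\Theta^{\mathsf R}}_p\subseteq\widehat{\Theta^{\mathsf R}}_q$; and $\Theta'=\{\{\widehat{\Theta^{\mathsf R}}_c:c\in C\}:C\in\Theta\}\subseteq\mathcal C_X(\mathbb P')$ is a countable complete locally uniform compatible filter. Moreover, $\Theta'$ is countable as a set if and only if $\Theta$ is. (b) If $X$ is any topological space, $\mathbb P\subseteq\mathcal O(X)$, and $\Theta\subseteq\mathcal C_X(\mathbb P)$ is a locally uniform compatible filter, then $\Theta$ is admissible. (c) If $X$ is a completely metrisable space with basis $\mathbb P\subseteq\mathcal O(X)$ and $\Theta\subseteq\mathcal C_X(\mathbb P)$ is a countable complete locally uniform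 compatible filter, then $\Theta$ is a countable admissible filter on $(\mathbb P,\subseteq)$, and $x\mapsto\mathbb P_x$ is a homeomorphism from $X$ onto $\widehat{\Theta^{\mathsf R}}$. -/

import Mathlib

/-!
Posets `P` with a family `Θ` of subsets of `P`, their spectra, the uniformly-below relation,
regularisations, and concrete families of basic open covers of topological spaces.
-/

universe u v

namespace NearnessPoset

section Relations

variable {α : Type u}

/-- `R ≺ S` for subsets: every element of `R` is `≺` some element of `S`. -/
def Refines (r : α → α → Prop) (R S : Set α) : Prop :=
  ∀ a ∈ R, ∃ b ∈ S, r a b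

/-- `S` is `≺`-directed: every finite subset of `S` has a `≺`-lower bound in `S`. In particular `S`
is non-empty. -/
def IsDirectedFor (r : α → α → Prop) (S : Set α) : Prop :=
  ∀ F : Set α, F.Finite → F ⊆ S → ∃ s ∈ S, ∀ f ∈ F, r s f

/-- `S` is a `≺`-filter: a finite set lies in `S` if and only if it has a `≺`-lower bound
in `S`. -/
def IsFilterFor (r : α → α → Prop) (S : Set α) : Prop :=
  ∀ F : Set α, F.Finite → (F ⊆ S ↔ ∃ s ∈ S, ∀ f ∈ F, r s f)

end Relations

section Poset

variable {P : Type u} [PartialOrder P]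

/-- The family `Θ` is directed (for refinement). -/
def IsDirectedFamily (Θ : Set (Set P)) : Prop :=
  IsDirectedFor (Refines (fun p q : P => p ≤ q)) Θ

/-- The family `Θ` is a filter (for refinement). -/
def IsFilterFamily (Θ : Set (Set P)) : Prop :=
  IsFilterFor (Refines (fun p q : P => p ≤ q)) Θ

/-- `Θ` has a countable coinitial subfamily, i.e. a countable subfamily such that every member of
`Θ` is refined by a member of the subfamily. -/
def HasCountableBase (Θ : Set (Set P)) : Prop :=
  ∃ Θ₀ : Set (Set P), Θ₀ ⊆ Θ ∧ Θ₀.Countable ∧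
    ∀ C ∈ Θ, ∃ D ∈ Θ₀, Refines (fun p q : P => p ≤ q) D C

/-- A family that is countable as a set has a countable base. -/
theorem hasCountableBase_of_countable {Θ : Set (Set P)} (h : Θ.Countable) :
    HasCountableBase Θ :=
  ⟨Θ, subset_rfl, h, fun C hC => ⟨C, hC, fun a ha => ⟨a, ha, le_rfl⟩⟩⟩

/-- `S` is `Θ`-Cauchy: `S` meets every member of `Θ`. -/
def IsCauchy (Θ : Set (Set P)) (S : Set P) : Prop :=
  ∀ C ∈ Θ, (C ∩ S).Nonempty

/-- `S` is `Θ`-round. -/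
def IsRound (Θ : Set (Set P)) (S : Set P) : Prop :=
  ∀ s ∈ S, ∃ C ∈ Θ, ∀ c ∈ C ∩ S, c ≤ s

/-- The points of the spectrum: `Θ`-round `Θ`-Cauchy up-sets. -/
def IsPoint (Θ : Set (Set P)) (R : Set P) : Prop :=
  IsRound Θ R ∧ IsCauchy Θ R ∧ IsUpperSet R

/-- The underlying type of the `Θ`-spectrum. -/
@[ext]
structure Spectrum (Θ : Set (Set P)) : Type u where
  carrier : Set P
  isPoint : IsPoint Θ carrier

/-- The subbasic set of all points of the spectrum that contain `p`. -/
def specOpen (Θ : Set (Set P)) (p : P) : Set (Spectrum Θ) :=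
  {R | p ∈ R.carrier}

/-- The family of all `specOpen Θ p`. -/
def specBasis (Θ : Set (Set P)) : Set (Set (Spectrum Θ)) :=
  Set.range (specOpen Θ)

/-- The spectrum has the sets `specOpen Θ p` as a subbasis. -/
instance (Θ : Set (Set P)) : TopologicalSpace (Spectrum Θ) :=
  TopologicalSpace.generateFrom (specBasis Θ)

/-- The family of all subsets that are refined by some member of `Θ`. -/
def upClosure (Θ : Set (Set P)) : Set (Set P) :=
  {D | ∃ C ∈ Θ, Refines (fun p q : P => p ≤ q) C D}

/-- `S` is `Θ`-near. -/
def IsNear (Θ : Set (Set P)) (S : Set P) : Prop :=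
  ∃ D, D ∉ Θ ∧ ∀ s ∈ S, D ∪ {s} ∈ Θ

/-- The set of all `p` for which `{p}` is near with respect to the up-closure of `Θ`. -/
def nearElements (Θ : Set (Set P)) : Set P :=
  {p | IsNear (upClosure Θ) {p}}

/-- The `C`-star of `p`, with respect to `Θ`. -/
def starOf (Θ : Set (Set P)) (C : Set P) (p : P) : Set P :=
  {c | c ∈ C ∧ IsNear (upClosure Θ) {c, p}}

/-- `p` is uniformly below `q`, with respect to `Θ`. -/
def UniformlyBelow (Θ : Set (Set P)) (p q : P) : Prop :=
  ∃ C ∈ Θ, ∀ c ∈ starOf Θ C p, c ≤ q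

/-- `Θ` is admissible: every `p` is the supremum of the elements uniformly below it. -/
def IsAdmissible (Θ : Set (Set P)) : Prop :=
  ∀ p : P, IsLUB {q | UniformlyBelow Θ q p} p

/-- `Θ` is star-regular. -/
def IsStarRegular (Θ : Set (Set P)) : Prop :=
  ∀ p : P, ∀ C ∈ Θ, ∃ D ∈ Θ, Refines (UniformlyBelow Θ) (starOf Θ D p) C

/-- The set of all elements that are uniformly below (with respect to `Θ`) some element of `C`. -/
def shrink (Θ : Set (Set P)) (C : Set P) : Set P :=
  {p | ∃ c ∈ C, UniformlyBelow Θ p c}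

/-- The regularisation of `Θ`: all the sets obtained from members of `Θ` by shrinking finitely many
times, where shrinking always refers to the uniformly-below relation of the original `Θ`. -/
def regularisation (Θ : Set (Set P)) : Set (Set P) :=
  ⋃ n : ℕ, (fun Ξ : Set (Set P) => shrink Θ '' Ξ)^[n] Θ

/-- The abstract side of the duality. -/
structure IsCountableAdmissibleFilter (Θ : Set (Set P)) : Prop where
  isFilter : IsFilterFamily Θ
  isAdmissible : IsAdmissible Θ
  hasCountableBase : HasCountableBase Θ

/-- `specOpen Ξ p` as an element of `specBasis Ξ`. -/
def toSpecBasis (Ξ : Set (Set P)) (p : P) : specBasis Ξ :=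
  ⟨specOpen Ξ p, Set.mem_range_self p⟩

/-- The families `{specOpen Ξ c | c ∈ C}`, for `C ∈ Θ`. -/
def specCovers (Ξ Θ : Set (Set P)) : Set (Set (specBasis Ξ)) :=
  (fun C : Set P => toSpecBasis Ξ '' C) '' Θ

end Poset

section Concrete

variable {X : Type v} {B : Set (Set X)}

/-! Here `B` is a family of subsets of `X`, regarded as a poset under inclusion (the order that the
subtype inherits from `Set X`), and `Θ` is a family of subsets of `B`. -/

/-- The set of all members of `B` that contain `x`. -/
def elementsAt (B : Set (Set X)) (x : X) : Set B :=
  {b | x ∈ (b : Set X)}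

/-- The union of the members of `C` that contain `x`. -/
def unionAt (C : Set B) (x : X) : Set X :=
  {y | ∃ c ∈ C, x ∈ (c : Set X) ∧ y ∈ (c : Set X)}

/-- The union of the members of `C` that meet `A`. -/
def unionMeeting (C : Set B) (A : Set X) : Set X :=
  {y | ∃ c ∈ C, ((c : Set X) ∩ A).Nonempty ∧ y ∈ (c : Set X)}

/-- All members of `Θ` cover `X`. -/
def ConsistsOfCovers (Θ : Set (Set B)) : Prop :=
  ∀ C ∈ Θ, ∀ x : X, ∃ c ∈ C, x ∈ (c : Set X)

/-- `Θ` is locally uniform. -/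
def IsLocallyUniform (Θ : Set (Set B)) : Prop :=
  ∀ x : X, ∀ C ∈ Θ, ∃ D ∈ Θ, unionMeeting D (unionAt D x) ⊆ unionAt C x

/-- `Θ` is compatible with the topology: at every `x`, the sets `unionAt C x` for `C ∈ Θ` are a
neighbourhood base. -/
def IsCompatible [TopologicalSpace X] (Θ : Set (Set B)) : Prop :=
  ∀ x : X, (nhds x).HasBasis (fun C : Set B => C ∈ Θ) (fun C => unionAt C x)

/-- `Θ` is complete: every `Θ`-Cauchy filter for the uniformly-below relation converges to some
point of `X`. -/
def IsCompleteFamily (Θ : Set (Set B)) : Prop :=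
  ∀ R : Set B, IsCauchy Θ R → IsFilterFor (UniformlyBelow Θ) R → ∃ x : X, elementsAt B x ⊆ R

/-- The concrete side of the duality. -/
structure IsConcreteCoverFilter (X : Type v) [TopologicalSpace X] (B : Set (Set X))
    (Θ : Set (Set B)) : Prop where
  completelyMetrisable : TopologicalSpace.IsCompletelyMetrizableSpace X
  isBasis : TopologicalSpace.IsTopologicalBasis B
  covers : ConsistsOfCovers Θ
  isFilter : IsFilterFamily Θ
  hasCountableBase : HasCountableBase Θ
  complete : IsCompleteFamily Θ
  locallyUniform : IsLocallyUniform Θ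
  compatible : IsCompatible Θ

end Concrete

end NearnessPoset

open NearnessPoset

/-! Points of a spectrum are traces of points on a basis, and `UniformlyBelow` is uniform inclusion
of one star in another set. Three mechanisms carry the proof. Metrisation: for a decreasing
coinitial sequence `C n`, a point `R` has the neighbourhoods `V n R`, the union of the basic sets
indexed by `C n ∩ R`. If every element of `R` has another element of `R` uniformly below it, then
stars of stars shrink (`Spectrum.exists_double_star`), which is Frink's condition. Star-regularity
makes filters with small members converge. Regularisation: `shrink Θ C` consists of elements
uniformly below members of `C`, so the regularisation is star-regular at once. What needs proof is
that near elements and near pairs stay the same, and that the possibly larger uniformly-below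
relation still implies `≤`. Both follow by induction on the number of shrinkings, because in an
admissible family every element is the supremum of those uniformly below it. Duality: if `p ≤ q`
fails, a descending sequence from `p` can pass through every cover of a countable base without ever
dropping below `q`; it generates a point containing `p` but not `q`. Hence `P` is order isomorphic
to the basis of its spectrum. Conversely, for open covers near pairs are the intersecting ones, so
the basic sets at a point form a Cauchy filter, and completeness says that there are no other
points. -/

/-! ### Metrisation by entourages and by Frink's condition -/

open Filter Topology TopologicalSpace in
/-- A `T₀` space whose neighbourhoods come from a sequence of entourages is completely metrisable as
soon as every filter with arbitrarily small members converges. -/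
theorem isCompletelyMetrizableSpace_of_entourages {X : Type*} [TopologicalSpace X] [T0Space X]
    (E : ℕ → X → X → Prop) (refl : ∀ n x, E n x x) (symm : ∀ n x y, E n x y → E n y x)
    (comp : ∀ n x y z, E (n + 1) x y → E (n + 1) y z → E n x z)
    (hnhds : ∀ x, (𝓝 x).HasBasis (fun _ : ℕ => True) (fun n => {y | E n x y}))
    (hcomplete : ∀ F : Filter X, F.NeBot → (∀ n, ∃ x, {y | E n x y} ∈ F) → ∃ x, F ≤ 𝓝 x) :
    IsCompletelyMetrizableSpace X := by
  have anti : Antitone (fun n => {p : X × X | E n p.1 p.2}) :=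
    antitone_nat_of_succ_le fun n p hp => comp n _ _ _ hp (refl _ _)
  have hb : (⨅ n, 𝓟 {p : X × X | E n p.1 p.2}).HasBasis (fun _ : ℕ => True)
      (fun n => {p : X × X | E n p.1 p.2}) :=
    hasBasis_iInf_principal anti.directed_ge
  let core : UniformSpace.Core X :=
    { uniformity := ⨅ n, 𝓟 {p : X × X | E n p.1 p.2}
      refl := hb.ge_iff.mpr fun n _ => by
        rintro ⟨x, y⟩ h
        obtain rfl : x = y := by simpa using h
        exact refl n x
      symm := (hb.tendsto_iff hb).mpr fun n _ => ⟨n, trivial, fun p hp => symm n _ _ hp⟩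
      comp := ((hb.lift' (monotone_id.relComp monotone_id)).le_basis_iff hb).2 fun n _ =>
        ⟨n + 1, trivial, by
          rintro ⟨x, z⟩ ⟨y, hxy, hyz⟩
          exact comp n x y z hxy hyz⟩ }
  have htop : ‹TopologicalSpace X› = core.toTopologicalSpace := by
    refine TopologicalSpace.ext_nhds fun x => ?_
    rw [core.nhds_toTopologicalSpace]
    exact (hnhds x).eq_of_same_basis (hb.comap (Prod.mk x))
  let _ : UniformSpace X := UniformSpace.ofCoreEq core _ htop
  have hu : (uniformity X).HasBasis (fun _ : ℕ => True)
      (fun n => {p : X × X | E n p.1 p.2}) := hb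
  have : (uniformity X).IsCountablyGenerated := HasCountableBasis.isCountablyGenerated
    ⟨hu, Set.to_countable _⟩
  have : CompleteSpace X := ⟨fun {F} hF => by
    obtain ⟨hne, hF⟩ := (hu.cauchy_iff).1 hF
    refine hcomplete F hne fun n => ?_
    obtain ⟨t, ht, h⟩ := hF n trivial
    obtain ⟨x, hx⟩ := hne.nonempty_of_mem ht
    exact ⟨x, mem_of_superset ht fun y hy => h x hx y hy⟩⟩
  infer_instance

open Filter Topology TopologicalSpace in
/-- Frink's metrisation theorem, with completeness measured by a sequence of covers. -/
theorem isCompletelyMetrizableSpace_of_frink {X : Type*} [TopologicalSpace X] [T0Space X]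
    (V : ℕ → X → Set X) (anti : ∀ x, Antitone fun n => V n x)
    (hnhds : ∀ x, (𝓝 x).HasBasis (fun _ : ℕ => True) (fun n => V n x))
    (frink : ∀ x n, ∃ m, ∀ y, (V m y ∩ V m x).Nonempty → V m y ⊆ V n x)
    (W : ℕ → Set (Set X)) (small : ∀ x n, ∃ m, ∃ w ∈ W n, V m x ⊆ w)
    (hcomplete : ∀ F : Filter X, F.NeBot → (∀ n, ∃ w ∈ W n, w ∈ F) → ∃ x, F ≤ 𝓝 x) :
    IsCompletelyMetrizableSpace X := by
  have hmem : ∀ n x, x ∈ V n x := fun n x => mem_of_mem_nhds ((hnhds x).mem_of_mem trivial)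
  choose M hM using frink
  choose N w hw hN using small
  have hM' : ∀ x n m y, M x n ≤ m → (V m y ∩ V m x).Nonempty → V m y ⊆ V n x :=
    fun x n m y h ⟨z, hz⟩ => (anti y h).trans (hM x n y ⟨z, anti y h hz.1, anti x h hz.2⟩)
  -- The radius index at stage `n + 1` is large enough for Frink's condition relative to stage `n`,
  -- for smallness in `W n`, and for `k` to be monotone in `n` with `n ≤ k n x`.
  let k : ℕ → X → ℕ := fun n x =>
    Nat.rec 0 (fun n r => max (max (M x r) (N x n)) (max (n + 1) r)) n
  have hk : ∀ n x, k (n + 1) x = max (max (M x (k n x)) (N x n)) (max (n + 1) (k n x)) :=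
    fun _ _ => rfl
  have hkn : ∀ n x, n ≤ k n x := by
    rintro (_ | n) x
    · exact Nat.zero_le _
    · rw [hk]; exact (le_max_left _ _).trans (le_max_right _ _)
  let U : ℕ → X → Set X := fun n x => V (k n x) x
  have step : ∀ n a b, (U (n + 1) a ∩ U (n + 1) b).Nonempty → k (n + 1) b ≤ k (n + 1) a →
      U (n + 1) a ⊆ U n b := by
    rintro n a b ⟨z, hza, hzb⟩ hab
    refine (anti a hab).trans (hM' b (k n b) _ a ?_ ⟨z, anti a hab hza, hzb⟩)
    rw [hk]; exact (le_max_left _ _).trans (le_max_left _ _)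
  have usub : ∀ n a, U (n + 1) a ⊆ U n a := fun n a => anti a <| by
    rw [hk]; exact (le_max_right _ _).trans (le_max_right _ _)
  have umem : ∀ n a, a ∈ U n a := fun n a => hmem _ a
  have star : ∀ n x, ∃ b, {y | ∃ a, x ∈ U (n + 1) a ∧ y ∈ U (n + 1) a} ⊆ U n b := by
    intro n x
    -- Among all centres whose set contains `x`, one of least index works, since `step` absorbs
    -- every set of larger index into the previous stage around it.
    let S : Set ℕ := {j | ∃ a, x ∈ U (n + 1) a ∧ k (n + 1) a = j}
    have hS : S.Nonempty := ⟨_, x, umem (n + 1) x, rfl⟩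
    obtain ⟨b, hb, hbk⟩ := Nat.sInf_mem hS
    refine ⟨b, ?_⟩
    rintro y ⟨a, hxa, hya⟩
    exact step n a b ⟨x, hxa, hb⟩ (hbk ▸ Nat.sInf_le ⟨a, hxa, rfl⟩) hya
  refine isCompletelyMetrizableSpace_of_entourages
    (fun n x y => ∃ a, x ∈ U n a ∧ y ∈ U n a) (fun n x => ⟨x, umem n x, umem n x⟩)
    (fun n x y ⟨a, hx, hy⟩ => ⟨a, hy, hx⟩) ?_ ?_ ?_
  · intro n x y z hxy hyz
    obtain ⟨b, hb⟩ := star n y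
    obtain ⟨a, hx, hy⟩ := hxy
    exact ⟨b, hb ⟨a, hy, hx⟩, hb hyz⟩
  · intro x
    refine (hnhds x).to_hasBasis (fun n _ => ⟨M x n, trivial, ?_⟩) (fun n _ => ?_)
    · rintro y ⟨a, hx, hy⟩
      have h := anti a (hkn (M x n) a)
      exact hM x n a ⟨x, h hx, hmem _ x⟩ (h hy)
    · exact ⟨k n x, trivial, fun y hy => ⟨x, umem n x, hy⟩⟩
  · intro F hF h
    refine hcomplete F hF fun n => ?_
    -- One stage is spent on passing from the ball to a single `U (n + 1) b`, the other because
    -- smallness in `W n` is built into stage `n + 1`.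
    obtain ⟨x, hx⟩ := h (n + 2)
    obtain ⟨b, hb⟩ := star (n + 1) x
    refine ⟨w b n, hw b n, mem_of_superset hx (hb.trans ?_)⟩
    refine (anti b ?_).trans (hN b n)
    rw [hk]; exact (le_max_right _ _).trans (le_max_left _ _)

/-! ### Nearness, filters and the spectrum of a star-regular family -/

namespace NearnessPoset

section Relations

variable {P : Type u}

theorem IsFilterFor.exists_forall {r : P → P → Prop} {R F : Set P} (hR : IsFilterFor r R)
    (hF : F.Finite) (hFR : F ⊆ R) : ∃ s ∈ R, ∀ f ∈ F, r s f :=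
  (hR F hF).1 hFR

theorem IsFilterFor.exists_rel {r : P → P → Prop} {R : Set P} (hR : IsFilterFor r R) {p : P}
    (hp : p ∈ R) : ∃ s ∈ R, r s p := by
  obtain ⟨s, hs, h⟩ := hR.exists_forall (Set.finite_singleton p) (Set.singleton_subset_iff.2 hp)
  exact ⟨s, hs, h p rfl⟩

theorem IsFilterFor.exists_rel_pair {r : P → P → Prop} {R : Set P} (hR : IsFilterFor r R)
    {p q : P} (hp : p ∈ R) (hq : q ∈ R) : ∃ s ∈ R, r s p ∧ r s q := by
  obtain ⟨s, hs, h⟩ := hR.exists_forall (F := {p, q}) (Set.toFinite _)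
    (by rintro _ (rfl | rfl) <;> assumption)
  exact ⟨s, hs, h p (by simp), h q (by simp)⟩

theorem IsFilterFor.mem_of_rel {r : P → P → Prop} {R : Set P} (hR : IsFilterFor r R)
    {p q : P} (hp : p ∈ R) (hpq : r p q) : q ∈ R :=
  Set.singleton_subset_iff.1 <| (hR {q} (Set.finite_singleton q)).2
    ⟨p, hp, by rintro _ rfl; exact hpq⟩

theorem isFilterFor_of_forall_exists {r : P → P → Prop} {R : Set P}
    (h : ∀ F : Set P, F.Finite → F ⊆ R → ∃ s ∈ R, ∀ f ∈ F, r s f)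
    (h' : ∀ s ∈ R, ∀ q, r s q → q ∈ R) : IsFilterFor r R :=
  fun F hF => ⟨h F hF, fun ⟨s, hs, hsF⟩ f hf => h' s hs f (hsF f hf)⟩

end Relations

section Poset

variable {P : Type u} [PartialOrder P] {Θ : Set (Set P)}

theorem Refines.trans_le {C D E : Set P} (h : Refines (fun p q : P => p ≤ q) C D)
    (h' : Refines (fun p q : P => p ≤ q) D E) : Refines (fun p q : P => p ≤ q) C E := by
  intro c hc
  obtain ⟨d, hd, hcd⟩ := h c hc
  obtain ⟨e, he, hde⟩ := h' d hd
  exact ⟨e, he, hcd.trans hde⟩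

theorem refines_refl (C : Set P) : Refines (fun p q : P => p ≤ q) C C :=
  fun c hc => ⟨c, hc, le_rfl⟩

theorem subset_upClosure : Θ ⊆ upClosure Θ := fun C hC => ⟨C, hC, refines_refl C⟩

theorem mem_upClosure_of_refines {C D : Set P} (hC : C ∈ upClosure Θ)
    (h : Refines (fun p q : P => p ≤ q) C D) : D ∈ upClosure Θ := by
  obtain ⟨E, hE, hEC⟩ := hC
  exact ⟨E, hE, hEC.trans_le h⟩

theorem IsDirectedFamily.nonempty (h : IsDirectedFamily Θ) : Θ.Nonempty := by
  obtain ⟨C, hC, -⟩ := h ∅ Set.finite_empty (Set.empty_subset _)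
  exact ⟨C, hC⟩

theorem IsDirectedFamily.exists_pair (h : IsDirectedFamily Θ) {C D : Set P} (hC : C ∈ Θ)
    (hD : D ∈ Θ) : ∃ E ∈ Θ, Refines (fun p q : P => p ≤ q) E C ∧
      Refines (fun p q : P => p ≤ q) E D := by
  obtain ⟨E, hE, hs⟩ := h {C, D} (Set.toFinite _) (by
    rintro _ (rfl | rfl) <;> assumption)
  exact ⟨E, hE, hs C (by simp), hs D (by simp)⟩

theorem IsDirectedFamily.exists_forall (h : IsDirectedFamily Θ) {F : Set P} (hF : F.Finite)
    {φ : Set P → P → Prop}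
    (mono : ∀ C D f, Refines (fun p q : P => p ≤ q) D C → φ C f → φ D f)
    (hφ : ∀ f ∈ F, ∃ C ∈ Θ, φ C f) : ∃ C ∈ Θ, ∀ f ∈ F, φ C f := by
  choose! C hC hCf using hφ
  obtain ⟨E, hE, hEC⟩ := h (C '' F) (hF.image C) (by
    rintro _ ⟨f, hf, rfl⟩
    exact hC f hf)
  exact ⟨E, hE, fun f hf => mono _ _ f (hEC _ (Set.mem_image_of_mem C hf)) (hCf f hf)⟩

theorem isNear_upClosure_of_le {S T : Set P} (hS : IsNear (upClosure Θ) S)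
    (h : ∀ t ∈ T, ∃ s ∈ S, s ≤ t) : IsNear (upClosure Θ) T := by
  obtain ⟨D, hD, hDS⟩ := hS
  refine ⟨D, hD, fun t ht => ?_⟩
  obtain ⟨s, hs, hst⟩ := h t ht
  refine mem_upClosure_of_refines (hDS s hs) ?_
  rintro c (hc | rfl)
  · exact ⟨c, Or.inl hc, le_rfl⟩
  · exact ⟨t, Or.inr rfl, hst⟩

theorem isNear_pair_of_le {p q p' q' : P} (h : IsNear (upClosure Θ) {p, q}) (hp : p ≤ p')
    (hq : q ≤ q') : IsNear (upClosure Θ) {p', q'} :=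
  isNear_upClosure_of_le h (by
    rintro t (rfl | rfl)
    · exact ⟨p, by simp, hp⟩
    · exact ⟨q, by simp, hq⟩)

theorem isNear_pair_of_mem {r p q : P} (h : r ∈ nearElements Θ) (hp : r ≤ p) (hq : r ≤ q) :
    IsNear (upClosure Θ) {p, q} :=
  isNear_upClosure_of_le h (by
    rintro t (rfl | rfl)
    · exact ⟨r, rfl, hp⟩
    · exact ⟨r, rfl, hq⟩)

theorem isUpperSet_nearElements : IsUpperSet (nearElements Θ) := by
  intro p q hpq hp
  refine isNear_upClosure_of_le (S := {p}) hp ?_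
  rintro t rfl
  exact ⟨p, rfl, hpq⟩

theorem right_mem_nearElements {p q : P} (h : IsNear (upClosure Θ) {p, q}) :
    q ∈ nearElements Θ :=
  isNear_upClosure_of_le h (by
    rintro t rfl
    exact ⟨t, by simp, le_rfl⟩)

theorem UniformlyBelow.le_left {r p q : P} (hr : r ≤ p) (h : UniformlyBelow Θ p q) :
    UniformlyBelow Θ r q := by
  obtain ⟨C, hC, h⟩ := h
  exact ⟨C, hC, fun c hc => h c ⟨hc.1, isNear_pair_of_le hc.2 le_rfl hr⟩⟩

theorem UniformlyBelow.le_right {p q r : P} (h : UniformlyBelow Θ p q) (hr : q ≤ r) :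
    UniformlyBelow Θ p r := by
  obtain ⟨C, hC, h⟩ := h
  exact ⟨C, hC, fun c hc => (h c hc).trans hr⟩

theorem forall_starOf_le_of_refines {C D : Set P} {p q : P}
    (hDC : Refines (fun p q : P => p ≤ q) D C) (h : ∀ c ∈ starOf Θ C p, c ≤ q) :
    ∀ d ∈ starOf Θ D p, d ≤ q := by
  intro d hd
  obtain ⟨c, hc, hdc⟩ := hDC d hd.1
  exact hdc.trans (h c ⟨hc, isNear_pair_of_le hd.2 hdc le_rfl⟩)

/-- Points of the spectrum are near. -/
theorem IsPoint.isNear {R S : Set P} (hR : IsPoint Θ R) (hS : S ⊆ R) :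
    IsNear (upClosure Θ) S := by
  obtain ⟨round, cauchy, up⟩ := hR
  -- The complement of `R` is not refined by any member of `Θ`, as `R` is a Cauchy up-set; roundness
  -- says that adding any single `s ∈ R` makes it so.
  refine ⟨Rᶜ, ?_, fun s hs => ?_⟩
  · rintro ⟨C, hC, h⟩
    obtain ⟨c, hcC, hcR⟩ := cauchy C hC
    obtain ⟨d, hd, hcd⟩ := h c hcC
    exact hd (up hcd hcR)
  · obtain ⟨C, hC, h⟩ := round s (hS hs)
    refine ⟨C, hC, fun c hc => ?_⟩
    by_cases hcR : c ∈ R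
    · exact ⟨s, Or.inr rfl, h c ⟨hc, hcR⟩⟩
    · exact ⟨c, Or.inl hcR, le_rfl⟩

theorem IsPoint.subset_nearElements {R : Set P} (hR : IsPoint Θ R) : R ⊆ nearElements Θ :=
  fun _ hr => hR.isNear (Set.singleton_subset_iff.2 hr)

theorem IsPoint.isNear_pair {R : Set P} (hR : IsPoint Θ R) {p q : P} (hp : p ∈ R) (hq : q ∈ R) :
    IsNear (upClosure Θ) {p, q} :=
  hR.isNear (by rintro _ (rfl | rfl) <;> assumption)

/-- Over a directed family, the points of the spectrum contain lower bounds of their finite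
subsets in a strong sense. -/
theorem IsPoint.exists_forall_le (hΘ : IsDirectedFamily Θ) {R : Set P} (hR : IsPoint Θ R)
    {F : Set P} (hF : F.Finite) (hFR : F ⊆ R) :
    ∃ C ∈ Θ, ∀ f ∈ F, ∀ c ∈ C ∩ R, c ≤ f := by
  refine hΘ.exists_forall hF (φ := fun C f => ∀ c ∈ C ∩ R, c ≤ f) ?_
    fun f hf => hR.1 f (hFR hf)
  intro C D f hDC h d hd
  obtain ⟨c, hc, hdc⟩ := hDC d hd.1
  exact hdc.trans (h c ⟨hc, hR.2.2 hdc hd.2⟩)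

theorem IsFilterFor.isUpperSet {R : Set P} (hR : IsFilterFor (UniformlyBelow Θ) R) :
    IsUpperSet R := by
  intro p q hpq hp
  obtain ⟨s, hs, hsp⟩ := hR.exists_rel hp
  exact hR.mem_of_rel hs (hsp.le_right hpq)

theorem isNear_pair_of_isFilterFor (hle : ∀ p q : P, UniformlyBelow Θ p q → p ≤ q) {R : Set P}
    (hR : IsFilterFor (UniformlyBelow Θ) R) (hn : R ⊆ nearElements Θ) {p q : P} (hp : p ∈ R)
    (hq : q ∈ R) : IsNear (upClosure Θ) {p, q} := by
  obtain ⟨s, hs, hsp, hsq⟩ := hR.exists_rel_pair hp hq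
  exact isNear_pair_of_mem (hn hs) (hle _ _ hsp) (hle _ _ hsq)

theorem isRound_of_isFilterFor (hle : ∀ p q : P, UniformlyBelow Θ p q → p ≤ q) {R : Set P}
    (hR : IsFilterFor (UniformlyBelow Θ) R) (hn : R ⊆ nearElements Θ) : IsRound Θ R := by
  intro s hs
  obtain ⟨r, hr, C, hC, h⟩ := hR.exists_rel hs
  exact ⟨C, hC, fun c hc => h c ⟨hc.1, isNear_pair_of_isFilterFor hle hR hn hc.2 hr⟩⟩

/-- The points of the spectrum of a star-regular directed family. -/
theorem isPoint_iff_of_isStarRegular (hstar : IsStarRegular Θ) (hdir : IsDirectedFamily Θ)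
    (hle : ∀ p q : P, UniformlyBelow Θ p q → p ≤ q) (R : Set P) :
    IsPoint Θ R ↔
      R ⊆ nearElements Θ ∧ IsCauchy Θ R ∧ IsFilterFor (UniformlyBelow Θ) R := by
  constructor
  · intro hR
    refine ⟨hR.subset_nearElements, hR.2.1, isFilterFor_of_forall_exists ?_
      fun s hs q hsq => hR.2.2 (hle _ _ hsq) hs⟩
    intro F hF hFR
    obtain ⟨C, hC, hCF⟩ := hR.exists_forall_le hdir hF hFR
    obtain ⟨p, -, hp⟩ := hR.2.1 C hC
    -- Any `p ∈ R` serves as the centre of the star: all of `D ∩ R` is near `p`, so some `d ∈ R` is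
    -- uniformly below a `c ∈ C ∩ R`, which lies below all of `F`.
    obtain ⟨D, hD, hDC⟩ := hstar p C hC
    obtain ⟨d, hd, hdR⟩ := hR.2.1 D hD
    obtain ⟨c, hc, hdc⟩ := hDC d ⟨hd, hR.isNear_pair hdR hp⟩
    exact ⟨d, hdR, fun f hf => hdc.le_right (hCF f hf c ⟨hc, hR.2.2 (hle _ _ hdc) hdR⟩)⟩
  · rintro ⟨hn, hc, hf⟩
    exact ⟨isRound_of_isFilterFor hle hf hn, hc, hf.isUpperSet⟩

theorem isOpen_specOpen (p : P) : IsOpen (specOpen Θ p) :=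
  TopologicalSpace.isOpen_generateFrom_of_mem ⟨p, rfl⟩

instance : T0Space (Spectrum Θ) := ⟨fun _ _ h => Spectrum.ext <| Set.ext fun p =>
  h.mem_open_iff (isOpen_specOpen p)⟩

theorem isTopologicalBasis_specBasis (hdir : IsDirectedFamily Θ) :
    TopologicalSpace.IsTopologicalBasis (specBasis Θ) := by
  refine
    { exists_subset_inter := ?_
      sUnion_eq := ?_
      eq_generateFrom := rfl }
  · rintro _ ⟨p, rfl⟩ _ ⟨q, rfl⟩ R ⟨hp, hq⟩
    obtain ⟨C, hC, h⟩ := R.isPoint.exists_forall_le hdir (F := {p, q}) (Set.toFinite _)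
      (by rintro _ (rfl | rfl) <;> assumption)
    obtain ⟨c, hc⟩ := R.isPoint.2.1 C hC
    exact ⟨_, ⟨c, rfl⟩, hc.2, fun S hS => ⟨S.isPoint.2.2 (h p (by simp) c hc) hS,
      S.isPoint.2.2 (h q (by simp) c hc) hS⟩⟩
  · refine Set.eq_univ_of_forall fun R => ?_
    obtain ⟨C, hC⟩ := hdir.nonempty
    obtain ⟨c, hc⟩ := R.isPoint.2.1 C hC
    exact ⟨_, ⟨c, rfl⟩, hc.2⟩

theorem IsDirectedFamily.exists_seq (hdir : IsDirectedFamily Θ) (hc : HasCountableBase Θ) :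
    ∃ C : ℕ → Set P, (∀ n, C n ∈ Θ) ∧
      (∀ m n, m ≤ n → Refines (fun p q : P => p ≤ q) (C n) (C m)) ∧
      ∀ D ∈ Θ, ∃ n, Refines (fun p q : P => p ≤ q) (C n) D := by
  obtain ⟨Θ₀, hsub, hcount, hΘ₀⟩ := hc
  obtain ⟨A, hA⟩ := hdir.nonempty
  obtain ⟨B, hB, -⟩ := hΘ₀ A hA
  obtain ⟨f, rfl⟩ := hcount.exists_eq_range ⟨B, hB⟩
  have hf : ∀ n, f n ∈ Θ := fun n => hsub ⟨n, rfl⟩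
  choose g hg hgl hgr using fun C D : Θ => hdir.exists_pair C.2 D.2
  let C : ℕ → Θ := fun n => Nat.rec ⟨f 0, hf 0⟩ (fun n c => ⟨g c ⟨f (n + 1), hf _⟩, hg _ _⟩) n
  have hC : ∀ n, (C n).1 ∈ Θ := fun n => (C n).2
  refine ⟨fun n => (C n).1, hC, ?_, ?_⟩
  · intro m n hmn
    induction n, hmn using Nat.le_induction with
    | base => exact refines_refl _
    | succ n _ ih => exact (hgl (C n) ⟨f (n + 1), hf _⟩).trans_le ih
  · intro D hD
    obtain ⟨_, ⟨n, rfl⟩, hn⟩ := hΘ₀ D hD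
    refine ⟨n, Refines.trans_le ?_ hn⟩
    cases n with
    | zero => exact refines_refl _
    | succ n => exact hgr (C n) ⟨f (n + 1), hf _⟩

/-- The double star condition at a point of the spectrum. -/
theorem Spectrum.exists_double_star (hdir : IsDirectedFamily Θ)
    (hfil : ∀ R : Spectrum Θ, ∀ p ∈ R.carrier, ∃ q ∈ R.carrier, UniformlyBelow Θ q p)
    (R : Spectrum Θ) {C : Set P} (hC : C ∈ Θ) :
    ∃ D ∈ Θ, ∃ c ∈ C, c ∈ R.carrier ∧ ∀ e ∈ D, e ∈ R.carrier → ∀ d ∈ D,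
      (specOpen Θ d ∩ specOpen Θ e).Nonempty → d ≤ c := by
  obtain ⟨c, hc, hcR⟩ := R.isPoint.2.1 C hC
  obtain ⟨d, hd, E, hE, hEc⟩ := hfil R c hcR
  obtain ⟨E', hE', hEd⟩ := R.isPoint.1 d hd
  obtain ⟨D, hD, hDE, hDE'⟩ := hdir.exists_pair hE hE'
  refine ⟨D, hD, c, hc, hcR, ?_⟩
  rintro e he heR g hg ⟨S, hgS, heS⟩
  obtain ⟨e', he', hee'⟩ := hDE' e he
  -- Roundness puts `e` below `d`, so whatever meets `e` is near `d` and hence falls below `c`.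
  have hed : e ≤ d := hee'.trans (hEd e' ⟨he', R.isPoint.2.2 hee' heR⟩)
  exact forall_starOf_le_of_refines hDE hEc g
    ⟨hg, S.isPoint.isNear_pair hgS (S.isPoint.2.2 hed heS)⟩

/-- The spectrum of a star-regular directed family with a countable base is completely
metrisable. -/
theorem isCompletelyMetrizableSpace_spectrum (hstar : IsStarRegular Θ)
    (hdir : IsDirectedFamily Θ) (hle : ∀ p q : P, UniformlyBelow Θ p q → p ≤ q)
    (hcount : HasCountableBase Θ) :
    TopologicalSpace.IsCompletelyMetrizableSpace (Spectrum Θ) := by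
  obtain ⟨C, hC, anti, cof⟩ := hdir.exists_seq hcount
  have hfil : ∀ R : Spectrum Θ, ∀ p ∈ R.carrier, ∃ q ∈ R.carrier, UniformlyBelow Θ q p :=
    fun R p hp => (((isPoint_iff_of_isStarRegular hstar hdir hle _).1 R.isPoint).2.2).exists_rel hp
  let V : ℕ → Spectrum Θ → Set (Spectrum Θ) :=
    fun n R => {S | ∃ c ∈ C n, c ∈ R.carrier ∧ c ∈ S.carrier}
  have hanti : ∀ R, Antitone fun n => V n R := by
    rintro R m n hmn S ⟨c, hc, hcR, hcS⟩
    obtain ⟨d, hd, hcd⟩ := anti m n hmn c hc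
    exact ⟨d, hd, R.isPoint.2.2 hcd hcR, S.isPoint.2.2 hcd hcS⟩
  have hsmall : ∀ (R : Spectrum Θ) p, p ∈ R.carrier → ∃ n, V n R ⊆ specOpen Θ p := by
    intro R p hp
    obtain ⟨D, hD, h⟩ := R.isPoint.1 p hp
    obtain ⟨n, hn⟩ := cof D hD
    refine ⟨n, ?_⟩
    rintro S ⟨c, hc, hcR, hcS⟩
    obtain ⟨d, hd, hcd⟩ := hn c hc
    exact S.isPoint.2.2 (hcd.trans (h d ⟨hd, R.isPoint.2.2 hcd hcR⟩)) hcS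
  have hnhds : ∀ R, (nhds R).HasBasis (fun _ : ℕ => True) (fun n => V n R) := by
    intro R
    refine (isTopologicalBasis_specBasis hdir).nhds_hasBasis.to_hasBasis ?_ ?_
    · rintro _ ⟨⟨p, rfl⟩, hp⟩
      obtain ⟨n, hn⟩ := hsmall R p hp
      exact ⟨n, trivial, hn⟩
    · intro n _
      obtain ⟨c, hc, hcR⟩ := R.isPoint.2.1 _ (hC n)
      exact ⟨_, ⟨⟨c, rfl⟩, hcR⟩, fun S hS => ⟨c, hc, hcR, hS⟩⟩
  have hdouble : ∀ R n, ∃ m, ∀ k, m ≤ k → ∀ S ∈ V k R, V k S ⊆ V n R := by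
    intro R n
    obtain ⟨D, hD, c, hc, hcR, h⟩ := Spectrum.exists_double_star hdir hfil R (hC n)
    obtain ⟨m, hm⟩ := cof D hD
    refine ⟨m, ?_⟩
    rintro k hk S ⟨e, he, heR, heS⟩ T ⟨d, hd, hdS, hdT⟩
    obtain ⟨e', he', hee'⟩ := ((anti m k hk).trans_le hm) e he
    obtain ⟨d', hd', hdd'⟩ := ((anti m k hk).trans_le hm) d hd
    have := h e' he' (R.isPoint.2.2 hee' heR) d' hd'
      ⟨S, S.isPoint.2.2 hdd' hdS, S.isPoint.2.2 hee' heS⟩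
    exact ⟨c, hc, hcR, T.isPoint.2.2 (hdd'.trans this) hdT⟩
  have hsymm : ∀ n R S, S ∈ V n R → R ∈ V n S := fun n R S ⟨c, hc, hR, hS⟩ => ⟨c, hc, hS, hR⟩
  refine isCompletelyMetrizableSpace_of_frink V hanti hnhds ?_
    (fun n => specOpen Θ '' C n) ?_ ?_
  · intro R n
    obtain ⟨m₁, h₁⟩ := hdouble R n
    obtain ⟨m₂, h₂⟩ := hdouble R m₁
    -- `S` is reached from `R` in two steps through `Z`, and `T` in a third; `m₂` absorbs the first
    -- two steps and `m₁` the third.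
    refine ⟨max m₁ m₂, ?_⟩
    rintro S ⟨Z, hZS, hZR⟩
    intro T hT
    have hSR : S ∈ V m₁ R := h₂ _ (le_max_right _ _) Z hZR (hsymm _ _ _ hZS)
    exact h₁ m₁ le_rfl S hSR (hanti S (le_max_left m₁ m₂) hT)
  · intro R n
    obtain ⟨c, hc, hcR⟩ := R.isPoint.2.1 _ (hC n)
    obtain ⟨m, hm⟩ := hsmall R c hcR
    exact ⟨m, _, ⟨c, hc, rfl⟩, hm⟩
  · intro F hF hFC
    have hcau : ∀ D ∈ Θ, ∃ d ∈ D, specOpen Θ d ∈ F := by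
      intro D hD
      obtain ⟨n, hn⟩ := cof D hD
      obtain ⟨_, ⟨c, hc, rfl⟩, hcF⟩ := hFC n
      obtain ⟨d, hd, hcd⟩ := hn c hc
      exact ⟨d, hd, Filter.mem_of_superset hcF fun S hS => S.isPoint.2.2 hcd hS⟩
    have hnear : ∀ p q : P, specOpen Θ p ∈ F → specOpen Θ q ∈ F →
        IsNear (upClosure Θ) {p, q} := by
      intro p q hp hq
      obtain ⟨S, hSp, hSq⟩ := hF.nonempty_of_mem (Filter.inter_mem hp hq)
      exact S.isPoint.isNear_pair hSp hSq
    have hmono : ∀ p q : P, p ≤ q → specOpen Θ p ∈ F → specOpen Θ q ∈ F :=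
      fun p q hpq hp => Filter.mem_of_superset hp fun S hS => S.isPoint.2.2 hpq hS
    -- The elements whose basic set lies in `F` need not form a round set. Passing to what is
    -- uniformly above them gives roundness, and star-regularity keeps the result Cauchy.
    let R : Spectrum Θ := ⟨{q | ∃ p, specOpen Θ p ∈ F ∧ UniformlyBelow Θ p q}, by
      refine ⟨?_, ?_, ?_⟩
      · rintro q ⟨p, hp, D, hD, hDp⟩
        refine ⟨D, hD, ?_⟩
        rintro d ⟨hd, r, hr, hrd⟩
        exact hDp d ⟨hd, hnear d p (hmono r d (hle _ _ hrd) hr) hp⟩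
      · intro D hD
        obtain ⟨p, -, hp⟩ := hcau D hD
        obtain ⟨E, hE, hED⟩ := hstar p D hD
        obtain ⟨e, he, heF⟩ := hcau E hE
        obtain ⟨d, hd, hed⟩ := hED e ⟨he, hnear e p heF hp⟩
        exact ⟨d, hd, e, heF, hed⟩
      · rintro q r hqr ⟨p, hp, hpq⟩
        exact ⟨p, hp, hpq.le_right hqr⟩⟩
    refine ⟨R, (isTopologicalBasis_specBasis hdir).nhds_hasBasis.ge_iff.2 ?_⟩
    rintro _ ⟨⟨p, rfl⟩, r, hr, hrp⟩
    exact hmono r p (hle _ _ hrp) hr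

end Poset

end NearnessPoset

/-! ### Admissible families and their regularisation -/

namespace NearnessPoset

section Admissible

variable {P : Type u} [PartialOrder P] {Θ : Set (Set P)}

theorem mem_upClosure_of_not_mem_nearElements {p : P} (hp : p ∉ nearElements Θ) {D : Set P}
    (h : D ∪ {p} ∈ upClosure Θ) : D ∈ upClosure Θ := by
  by_contra hD
  exact hp ⟨D, hD, by rintro _ rfl; exact h⟩

/-- Under `hbot` an element that is not near is the least element of `P`, and it can be discarded
from a cover without loss. -/
theorem mem_upClosure_of_forall_le_or_not_mem (hbot : ∀ p ∉ nearElements Θ, ∀ q, p ≤ q)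
    {C D : Set P} (hC : C ∈ Θ) (h : ∀ c ∈ C, (∃ d ∈ D, c ≤ d) ∨ c ∉ nearElements Θ) :
    D ∈ upClosure Θ := by
  by_cases hz : ∃ z, z ∉ nearElements Θ
  · obtain ⟨z, hz⟩ := hz
    refine mem_upClosure_of_not_mem_nearElements hz ⟨C, hC, fun c hc => ?_⟩
    rcases h c hc with ⟨d, hd, hcd⟩ | hn
    · exact ⟨d, Or.inl hd, hcd⟩
    · exact ⟨z, Or.inr rfl, hbot c hn z⟩
  · exact ⟨C, hC, fun c hc => (h c hc).resolve_right fun hn => hz ⟨c, hn⟩⟩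

/-- Refine `D ∪ {p}` and `D ∪ {q}` simultaneously: if no near element lay below both, every near
member of the refinement would lie below `D`, putting `D` in the up-closure. -/
theorem exists_mem_nearElements_le_pair (hdir : IsDirectedFamily Θ)
    (hbot : ∀ p ∉ nearElements Θ, ∀ q, p ≤ q) {p q : P} (h : IsNear (upClosure Θ) {p, q}) :
    ∃ r ∈ nearElements Θ, r ≤ p ∧ r ≤ q := by
  obtain ⟨D, hD, h⟩ := h
  obtain ⟨A, hA, hAp⟩ := h p (by simp)
  obtain ⟨B, hB, hBq⟩ := h q (by simp)
  obtain ⟨C, hC, hCA, hCB⟩ := hdir.exists_pair hA hB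
  by_contra hno
  refine hD (mem_upClosure_of_forall_le_or_not_mem hbot hC fun c hc => ?_)
  obtain ⟨x, hx, hcx⟩ := (hCA.trans_le hAp) c hc
  obtain ⟨y, hy, hcy⟩ := (hCB.trans_le hBq) c hc
  rcases hx with hx | rfl
  · exact Or.inl ⟨x, hx, hcx⟩
  rcases hy with hy | rfl
  · exact Or.inl ⟨y, hy, hcy⟩
  exact Or.inr fun hn => hno ⟨c, hn, hcx, hcy⟩

theorem IsAdmissible.le_of_uniformlyBelow (hadm : IsAdmissible Θ) (p q : P)
    (h : UniformlyBelow Θ p q) : p ≤ q :=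
  (hadm q).1 h

theorem uniformlyBelow_of_not_mem_nearElements (hΘ : Θ.Nonempty) {p : P}
    (hp : p ∉ nearElements Θ) (q : P) : UniformlyBelow Θ p q := by
  obtain ⟨C, hC⟩ := hΘ
  exact ⟨C, hC, fun c hc => absurd (right_mem_nearElements hc.2) hp⟩

theorem IsAdmissible.le_of_not_mem_nearElements (hadm : IsAdmissible Θ) (hΘ : Θ.Nonempty) {p : P}
    (hp : p ∉ nearElements Θ) (q : P) : p ≤ q :=
  hadm.le_of_uniformlyBelow p q (uniformlyBelow_of_not_mem_nearElements hΘ hp q)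

theorem IsAdmissible.exists_near_uniformlyBelow (hadm : IsAdmissible Θ) (hΘ : Θ.Nonempty) {p : P}
    (hp : p ∈ nearElements Θ) : ∃ q ∈ nearElements Θ, UniformlyBelow Θ q p := by
  by_contra! hno
  -- If nothing near is uniformly below `p`, then `p` is a supremum of least elements, hence least
  -- itself. It is then an atom-like exception that is uniformly below itself.
  have hmin : ∀ q, p ≤ q := fun q => (hadm p).2 fun r hr =>
    hadm.le_of_not_mem_nearElements hΘ (fun hn => hno r hn hr) q
  refine hno p hp ?_
  obtain ⟨D, hD, h⟩ := hp
  obtain ⟨C, hC, hCD⟩ := h p rfl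
  refine ⟨C, hC, fun c hc => ?_⟩
  obtain ⟨d, hd | rfl, hcd⟩ := hCD c hc.1
  · refine absurd ?_ hD
    refine mem_upClosure_of_refines (h p rfl) ?_
    rintro x (hx | rfl)
    · exact ⟨x, hx, le_rfl⟩
    · exact ⟨d, hd, hmin d⟩
  · exact hcd

theorem IsAdmissible.isNear_pair_iff (hadm : IsAdmissible Θ) (hdir : IsDirectedFamily Θ)
    {p q : P} : IsNear (upClosure Θ) {p, q} ↔ ∃ r ∈ nearElements Θ, r ≤ p ∧ r ≤ q :=
  ⟨exists_mem_nearElements_le_pair hdir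
    fun _ hp q => hadm.le_of_not_mem_nearElements hdir.nonempty hp q,
    fun ⟨_, hr, hrp, hrq⟩ => isNear_pair_of_mem hr hrp hrq⟩

theorem empty_mem_of_empty_mem_upClosure (h : ∅ ∈ upClosure Θ) : ∅ ∈ Θ := by
  obtain ⟨C, hC, h⟩ := h
  have : C = ∅ := Set.eq_empty_of_forall_notMem fun c hc => by
    obtain ⟨d, hd, -⟩ := h c hc
    exact hd
  exact this ▸ hC

theorem IsAdmissible.empty_mem (hadm : IsAdmissible Θ) (hΘ : Θ.Nonempty)
    (hn : ∀ p : P, p ∉ nearElements Θ) : ∅ ∈ Θ := by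
  refine empty_mem_of_empty_mem_upClosure ?_
  have ⟨C, hC⟩ := hΘ
  rcases C.eq_empty_or_nonempty with rfl | ⟨p, hp⟩
  · exact subset_upClosure hC
  · exact mem_upClosure_of_not_mem_nearElements (hn p) ⟨C, hC, fun c _ =>
      ⟨p, Or.inr rfl, hadm.le_of_not_mem_nearElements hΘ (hn c) p⟩⟩

theorem shrink_mono {C D : Set P} (h : Refines (fun p q : P => p ≤ q) C D) :
    shrink Θ C ⊆ shrink Θ D := by
  rintro p ⟨c, hc, hpc⟩
  obtain ⟨d, hd, hcd⟩ := h c hc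
  exact ⟨d, hd, hpc.le_right hcd⟩

theorem IsAdmissible.shrink_refines (hadm : IsAdmissible Θ) (C : Set P) :
    Refines (fun p q : P => p ≤ q) (shrink Θ C) C :=
  fun _ ⟨c, hc, hpc⟩ => ⟨c, hc, hadm.le_of_uniformlyBelow _ _ hpc⟩

theorem mem_regularisation {D : Set P} :
    D ∈ regularisation Θ ↔ ∃ n : ℕ, ∃ C ∈ Θ, (shrink Θ)^[n] C = D := by
  simp only [regularisation, Set.mem_iUnion]
  refine exists_congr fun n => ?_
  rw [show (fun Ξ : Set (Set P) => shrink Θ '' Ξ)^[n] = Set.image (shrink Θ)^[n] from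
    Set.image_iterate_eq.symm]
  rfl

theorem subset_regularisation : Θ ⊆ regularisation Θ :=
  fun C hC => mem_regularisation.2 ⟨0, C, hC, rfl⟩

theorem shrink_mem_regularisation {C : Set P} (hC : C ∈ regularisation Θ) :
    shrink Θ C ∈ regularisation Θ := by
  obtain ⟨n, D, hD, rfl⟩ := mem_regularisation.1 hC
  exact mem_regularisation.2 ⟨n + 1, D, hD, Function.iterate_succ_apply' _ _ _⟩

theorem regularisation_induction {motive : Set P → Prop} (base : ∀ C ∈ Θ, motive C)
    (step : ∀ C, motive C → motive (shrink Θ C)) : ∀ C ∈ regularisation Θ, motive C := by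
  intro C hC
  obtain ⟨n, D, hD, rfl⟩ := mem_regularisation.1 hC
  clear hC
  induction n with
  | zero => exact base D hD
  | succ n ih =>
    rw [Function.iterate_succ_apply']
    exact step _ ih

theorem iterate_shrink_refines (n : ℕ) {C D : Set P}
    (h : Refines (fun p q : P => p ≤ q) C D) :
    Refines (fun p q : P => p ≤ q) ((shrink Θ)^[n] C) ((shrink Θ)^[n] D) := by
  induction n generalizing C D with
  | zero => exact h
  | succ n ih => exact ih fun p hp => ⟨p, shrink_mono h hp, le_rfl⟩

theorem IsAdmissible.iterate_shrink_refines_of_le (hadm : IsAdmissible Θ) {m n : ℕ} (h : m ≤ n)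
    (C : Set P) :
    Refines (fun p q : P => p ≤ q) ((shrink Θ)^[n] C) ((shrink Θ)^[m] C) := by
  induction n, h using Nat.le_induction with
  | base => exact refines_refl _
  | succ n _ ih =>
    rw [Function.iterate_succ_apply']
    exact (hadm.shrink_refines _).trans_le ih

theorem isDirectedFamily_of_pair {Ξ : Set (Set P)} (hne : Ξ.Nonempty)
    (h : ∀ C ∈ Ξ, ∀ D ∈ Ξ, ∃ E ∈ Ξ, Refines (fun p q : P => p ≤ q) E C ∧
      Refines (fun p q : P => p ≤ q) E D) : IsDirectedFamily Ξ := by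
  intro F hF
  induction F, hF using Set.Finite.induction_on with
  | empty =>
    intro _
    obtain ⟨C, hC⟩ := hne
    exact ⟨C, hC, fun _ h => absurd h (Set.notMem_empty _)⟩
  | @insert A F _ _ ih =>
    intro hsub
    obtain ⟨C, hC, hCF⟩ := ih ((Set.subset_insert A F).trans hsub)
    obtain ⟨E, hE, hEC, hEA⟩ := h C hC A (hsub (Set.mem_insert A F))
    refine ⟨E, hE, ?_⟩
    rintro _ (rfl | hB)
    · exact hEA
    · exact hEC.trans_le (hCF _ hB)

theorem IsAdmissible.isDirectedFamily_regularisation (hadm : IsAdmissible Θ)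
    (hdir : IsDirectedFamily Θ) : IsDirectedFamily (regularisation Θ) := by
  refine isDirectedFamily_of_pair (hdir.nonempty.mono subset_regularisation) ?_
  intro A hA B hB
  obtain ⟨m, C, hC, rfl⟩ := mem_regularisation.1 hA
  obtain ⟨n, D, hD, rfl⟩ := mem_regularisation.1 hB
  obtain ⟨E, hE, hEC, hED⟩ := hdir.exists_pair hC hD
  exact ⟨_, mem_regularisation.2 ⟨max m n, E, hE, rfl⟩,
    (hadm.iterate_shrink_refines_of_le (le_max_left m n) E).trans_le
      (iterate_shrink_refines m hEC),
    (hadm.iterate_shrink_refines_of_le (le_max_right m n) E).trans_le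
      (iterate_shrink_refines n hED)⟩

theorem hasCountableBase_regularisation (hc : HasCountableBase Θ) :
    HasCountableBase (regularisation Θ) := by
  obtain ⟨Θ₀, hsub, hcount, hΘ₀⟩ := hc
  refine ⟨⋃ n : ℕ, (shrink Θ)^[n] '' Θ₀, ?_, Set.countable_iUnion fun n => hcount.image _, ?_⟩
  · refine Set.iUnion_subset fun n => ?_
    rintro _ ⟨C, hC, rfl⟩
    exact mem_regularisation.2 ⟨n, C, hsub hC, rfl⟩
  · intro A hA
    obtain ⟨n, C, hC, rfl⟩ := mem_regularisation.1 hA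
    obtain ⟨D, hD, hDC⟩ := hΘ₀ C hC
    exact ⟨_, Set.mem_iUnion.2 ⟨n, D, hD, rfl⟩, iterate_shrink_refines n hDC⟩

/-- Every near element is near some element of each member of the regularisation. -/
theorem IsAdmissible.exists_mem_of_mem_regularisation (hadm : IsAdmissible Θ)
    (hdir : IsDirectedFamily Θ) {C : Set P} (hC : C ∈ regularisation Θ) :
    ∀ q ∈ nearElements Θ, ∃ c ∈ C, ∃ r ∈ nearElements Θ, r ≤ c ∧ r ≤ q := by
  refine regularisation_induction (motive := fun C => ∀ q ∈ nearElements Θ, ∃ c ∈ C,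
    ∃ r ∈ nearElements Θ, r ≤ c ∧ r ≤ q) ?_ ?_ C hC
  · rintro C hC q ⟨D, hD, h⟩
    obtain ⟨B, hB, hBq⟩ := h q rfl
    obtain ⟨A, hA, hAC, hAB⟩ := hdir.exists_pair hC hB
    by_contra hno
    refine hD (mem_upClosure_of_forall_le_or_not_mem
      (fun p hp => hadm.le_of_not_mem_nearElements hdir.nonempty hp) hA fun a ha => ?_)
    obtain ⟨c, hc, hac⟩ := hAC a ha
    obtain ⟨x, hx | rfl, hax⟩ := (hAB.trans_le hBq) a ha
    · exact Or.inl ⟨x, hx, hax⟩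
    · exact Or.inr fun hn => hno ⟨c, hc, a, hn, hac, hax⟩
  · intro C ih q hq
    obtain ⟨c, hc, r, hr, hrc, hrq⟩ := ih q hq
    -- Descending to a near element uniformly below `r` keeps the common lower bound while entering
    -- the shrunken cover.
    obtain ⟨s, hs, hsr⟩ := hadm.exists_near_uniformlyBelow hdir.nonempty hr
    exact ⟨s, ⟨c, hc, hsr.le_right hrc⟩, s, hs, le_rfl,
      (hadm.le_of_uniformlyBelow _ _ hsr).trans hrq⟩

theorem IsAdmissible.nearElements_regularisation (hadm : IsAdmissible Θ)
    (hdir : IsDirectedFamily Θ) : nearElements (regularisation Θ) = nearElements Θ := by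
  refine Set.Subset.antisymm (fun p hp => ?_) fun p hp => ?_
  · by_contra hnp
    have hbot := hadm.le_of_not_mem_nearElements hdir.nonempty hnp
    obtain ⟨D, hD, h⟩ := hp
    rcases D.eq_empty_or_nonempty with rfl | ⟨d, hd⟩
    · obtain ⟨C, hC, hCp⟩ := h p rfl
      by_cases hn : ∃ q, q ∈ nearElements Θ
      · obtain ⟨q, hq⟩ := hn
        obtain ⟨c, hc, r, hr, hrc, -⟩ := hadm.exists_mem_of_mem_regularisation hdir hC q hq
        obtain ⟨x, hx | rfl, hcx⟩ := hCp c hc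
        · exact hx
        · exact hnp (isUpperSet_nearElements (hrc.trans hcx) hr)
      · push Not at hn
        exact hD (subset_upClosure (subset_regularisation (hadm.empty_mem hdir.nonempty hn)))
    · refine hD (mem_upClosure_of_refines (h p rfl) ?_)
      rintro x (hx | rfl)
      · exact ⟨x, hx, le_rfl⟩
      · exact ⟨d, hd, hbot d⟩
  · obtain ⟨q, hq, C, hC, hCp⟩ := hadm.exists_near_uniformlyBelow hdir.nonempty hp
    -- Every member of the regularisation has an element near `q`, so none refines this set; adding
    -- `p` repairs it because `q` is uniformly below `p`.
    refine ⟨{c | ¬ IsNear (upClosure Θ) {c, q}}, ?_, ?_⟩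
    · rintro ⟨A, hA, h⟩
      obtain ⟨c, hc, r, hr, hrc, hrq⟩ := hadm.exists_mem_of_mem_regularisation hdir hA q hq
      obtain ⟨d, hd, hcd⟩ := h c hc
      exact hd (isNear_pair_of_mem hr (hrc.trans hcd) hrq)
    · rintro _ rfl
      refine ⟨C, subset_regularisation hC, fun c hc => ?_⟩
      by_cases hn : IsNear (upClosure Θ) {c, q}
      · exact ⟨_, Or.inr rfl, hCp c ⟨hc, hn⟩⟩
      · exact ⟨c, Or.inl hn, le_rfl⟩

/-- For both families a pair is near exactly when it has a near lower bound, and the near elements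
agree. -/
theorem IsAdmissible.isNear_pair_regularisation_iff (hadm : IsAdmissible Θ)
    (hdir : IsDirectedFamily Θ) {p q : P} :
    IsNear (upClosure (regularisation Θ)) {p, q} ↔ IsNear (upClosure Θ) {p, q} := by
  have hn := hadm.nearElements_regularisation hdir
  rw [hadm.isNear_pair_iff hdir, ← hn]
  refine ⟨exists_mem_nearElements_le_pair (hadm.isDirectedFamily_regularisation hdir) ?_,
    fun ⟨_, hr, hrp, hrq⟩ => isNear_pair_of_mem hr hrp hrq⟩
  rw [hn]
  exact fun p hp => hadm.le_of_not_mem_nearElements hdir.nonempty hp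

theorem IsAdmissible.uniformlyBelow_regularisation (hadm : IsAdmissible Θ)
    (hdir : IsDirectedFamily Θ) {p q : P} (h : UniformlyBelow Θ p q) :
    UniformlyBelow (regularisation Θ) p q := by
  obtain ⟨C, hC, h⟩ := h
  exact ⟨C, subset_regularisation hC,
    fun c hc => h c ⟨hc.1, (hadm.isNear_pair_regularisation_iff hdir).1 hc.2⟩⟩

/-- If, below some member of `Θ`, the elements below `p` are all below `q`, then `p ≤ q`. -/
theorem IsAdmissible.le_of_forall_le (hadm : IsAdmissible Θ) (hdir : IsDirectedFamily Θ) {p q : P}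
    {C : Set P} (hC : C ∈ Θ) (h : ∀ c ∈ C, ∀ g ≤ c, g ≤ p → g ≤ q) : p ≤ q := by
  refine (hadm p).2 fun t ⟨D, hD, hDt⟩ => hadm.le_of_uniformlyBelow t q ?_
  obtain ⟨E, hE, hED, hEC⟩ := hdir.exists_pair hD hC
  refine ⟨E, hE, fun e he => ?_⟩
  obtain ⟨c, hc, hec⟩ := hEC e he.1
  exact h c hc e hec (forall_starOf_le_of_refines hED hDt e he)

theorem IsAdmissible.le_of_uniformlyBelow_regularisation (hadm : IsAdmissible Θ)
    (hdir : IsDirectedFamily Θ) (p q : P) (h : UniformlyBelow (regularisation Θ) p q) :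
    p ≤ q := by
  obtain ⟨C, hC, h⟩ := h
  -- Quantifying over all `g` below `c` and `p` makes the induction work: such a `g` is the supremum
  -- of elements uniformly below it, and these lie in the shrunken cover.
  have key : ∀ C ∈ regularisation Θ, (∀ c ∈ C, ∀ g ≤ c, g ≤ p → g ≤ q) → p ≤ q := by
    refine regularisation_induction (fun C hC h => hadm.le_of_forall_le hdir hC h) ?_
    intro C ih h
    refine ih fun c hc g hgc hgp => (hadm g).2 fun k hk => ?_
    exact h k ⟨c, hc, hk.le_right hgc⟩ k le_rfl
      ((hadm.le_of_uniformlyBelow _ _ hk).trans hgp)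
  refine key C hC fun c hc g hgc hgp => ?_
  by_cases hg : g ∈ nearElements Θ
  · exact hgc.trans (h c ⟨hc,
      (hadm.isNear_pair_regularisation_iff hdir).2 (isNear_pair_of_mem hg hgc hgp)⟩)
  · exact hadm.le_of_not_mem_nearElements hdir.nonempty hg q

theorem IsAdmissible.isAdmissible_regularisation (hadm : IsAdmissible Θ)
    (hdir : IsDirectedFamily Θ) : IsAdmissible (regularisation Θ) := fun p =>
  ⟨fun q hq => hadm.le_of_uniformlyBelow_regularisation hdir q p hq,
    fun _ hu => (hadm p).2 fun _ hq => hu (hadm.uniformlyBelow_regularisation hdir hq)⟩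

/-- The whole of `shrink Θ C`, not just a star in it, is uniformly below `C`. -/
theorem IsAdmissible.isStarRegular_regularisation (hadm : IsAdmissible Θ)
    (hdir : IsDirectedFamily Θ) : IsStarRegular (regularisation Θ) := fun _ C hC =>
  ⟨shrink Θ C, shrink_mem_regularisation hC, fun _ hd =>
    let ⟨c, hc, hdc⟩ := hd.1
    ⟨c, hc, hadm.uniformlyBelow_regularisation hdir hdc⟩⟩

theorem IsFilterFor.isCauchy_regularisation {R : Set P}
    (hR : IsFilterFor (UniformlyBelow Θ) R) (hc : IsCauchy Θ R) :
    IsCauchy (regularisation Θ) R := by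
  refine regularisation_induction (motive := fun C => (C ∩ R).Nonempty) hc ?_
  rintro C ⟨c, hc, hcR⟩
  obtain ⟨r, hr, hrc⟩ := hR.exists_rel hcR
  exact ⟨r, ⟨c, hc, hrc⟩, hr⟩

/-- The points of the spectrum of the regularisation. -/
theorem IsAdmissible.isPoint_regularisation_iff (hadm : IsAdmissible Θ)
    (hdir : IsDirectedFamily Θ) (R : Set P) :
    IsPoint (regularisation Θ) R ↔
      R ⊆ nearElements Θ ∧ IsCauchy Θ R ∧ IsFilterFor (UniformlyBelow Θ) R := by
  have hle := hadm.le_of_uniformlyBelow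
  constructor
  · intro hR
    refine ⟨hadm.nearElements_regularisation hdir ▸ hR.subset_nearElements,
      fun C hC => hR.2.1 C (subset_regularisation hC), isFilterFor_of_forall_exists ?_
      fun s hs q hsq => hR.2.2 (hle _ _ hsq) hs⟩
    intro F hF hFR
    obtain ⟨C, hC, hCF⟩ := hR.exists_forall_le (hadm.isDirectedFamily_regularisation hdir) hF hFR
    obtain ⟨d, ⟨c, hc, hdc⟩, hdR⟩ := hR.2.1 _ (shrink_mem_regularisation hC)
    exact ⟨d, hdR, fun f hf => hdc.le_right (hCF f hf c ⟨hc, hR.2.2 (hle _ _ hdc) hdR⟩)⟩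
  · rintro ⟨hn, hc, hf⟩
    refine ⟨fun s hs => ?_, hf.isCauchy_regularisation hc, hf.isUpperSet⟩
    obtain ⟨C, hC, h⟩ := isRound_of_isFilterFor hle hf hn s hs
    exact ⟨C, subset_regularisation hC, h⟩

theorem IsAdmissible.isCompletelyMetrizableSpace_spectrum_regularisation (hadm : IsAdmissible Θ)
    (hdir : IsDirectedFamily Θ) (hcount : HasCountableBase Θ) :
    TopologicalSpace.IsCompletelyMetrizableSpace (Spectrum (regularisation Θ)) :=
  isCompletelyMetrizableSpace_spectrum (hadm.isStarRegular_regularisation hdir)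
    (hadm.isDirectedFamily_regularisation hdir)
    (hadm.le_of_uniformlyBelow_regularisation hdir) (hasCountableBase_regularisation hcount)

end Admissible

end NearnessPoset

/-! ### Transport along order isomorphisms -/

namespace NearnessPoset

theorem isFilterFor_image_iff {α β : Type*} (e : α ≃ β) {r : α → α → Prop} {r' : β → β → Prop}
    (h : ∀ a b, r' (e a) (e b) ↔ r a b) {S : Set α} :
    IsFilterFor r' (e '' S) ↔ IsFilterFor r S := by
  have hs : Function.Surjective (Set.image e) := Set.image_surjective.2 e.surjective
  unfold IsFilterFor
  rw [hs.forall]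
  refine forall_congr' fun F => ?_
  simp only [Set.finite_image_iff e.injective.injOn, Set.image_subset_image_iff e.injective,
    Set.exists_mem_image, Set.forall_mem_image, h]

section Transport

variable {P Q : Type*} [PartialOrder P] [PartialOrder Q] (e : P ≃o Q) {Θ : Set (Set P)}

theorem refines_image_iff {C D : Set P} :
    Refines (fun p q : Q => p ≤ q) (e '' C) (e '' D) ↔
      Refines (fun p q : P => p ≤ q) C D := by
  simp [Refines]

theorem image_mem_upClosure_iff {D : Set P} :
    e '' D ∈ upClosure ((fun C : Set P => e '' C) '' Θ) ↔ D ∈ upClosure Θ := by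
  simp [upClosure, refines_image_iff]

theorem isNear_image_iff {S : Set P} :
    IsNear (upClosure ((fun C : Set P => e '' C) '' Θ)) (e '' S) ↔ IsNear (upClosure Θ) S := by
  have hs : Function.Surjective (fun C : Set P => e '' C) := Set.image_surjective.2 e.surjective
  unfold IsNear
  rw [hs.exists]
  refine exists_congr fun D => and_congr (image_mem_upClosure_iff e).not ?_
  rw [Set.forall_mem_image]
  refine forall₂_congr fun s _ => ?_
  rw [← Set.image_singleton, ← Set.image_union, image_mem_upClosure_iff]

theorem uniformlyBelow_image_iff {p q : P} :
    UniformlyBelow ((fun C : Set P => e '' C) '' Θ) (e p) (e q) ↔ UniformlyBelow Θ p q := by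
  have hn : ∀ c, IsNear (upClosure ((fun C : Set P => e '' C) '' Θ)) {e c, e p} ↔
      IsNear (upClosure Θ) {c, p} := fun c => by
    rw [← Set.image_pair, isNear_image_iff]
  simp [UniformlyBelow, starOf, hn]

theorem isFilterFamily_image_iff :
    IsFilterFamily ((fun C : Set P => e '' C) '' Θ) ↔ IsFilterFamily Θ :=
  isFilterFor_image_iff (Equiv.Set.congr e.toEquiv) fun _ _ => refines_image_iff e

theorem HasCountableBase.image (h : HasCountableBase Θ) :
    HasCountableBase ((fun C : Set P => e '' C) '' Θ) := by
  obtain ⟨Θ₀, hsub, hcount, hΘ₀⟩ := h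
  refine ⟨_, Set.image_mono hsub, hcount.image _, ?_⟩
  rintro _ ⟨C, hC, rfl⟩
  obtain ⟨D, hD, hDC⟩ := hΘ₀ C hC
  exact ⟨_, Set.mem_image_of_mem _ hD, (refines_image_iff e).2 hDC⟩

end Transport

/-! ### Duality: from posets to covers of the spectrum -/

section Abstract

variable {P : Type u} [PartialOrder P] {Θ : Set (Set P)}

theorem IsFilterFamily.isDirectedFamily (h : IsFilterFamily Θ) : IsDirectedFamily Θ :=
  fun F hF hFΘ => (h F hF).1 hFΘ

theorem IsAdmissible.exists_uniformlyBelow_not_le (hadm : IsAdmissible Θ) {p q : P}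
    (h : ¬ p ≤ q) : ∃ r, UniformlyBelow Θ r p ∧ ¬ r ≤ q := by
  by_contra! hno
  exact h ((hadm p).2 hno)

/-- One step of the descent that separates `p` from `q`: shrink `p` into a given cover without
falling below `q`. -/
theorem IsAdmissible.exists_uniformlyBelow_mem_not_le (hadm : IsAdmissible Θ)
    (hdir : IsDirectedFamily Θ) {p q : P} (h : ¬ p ≤ q) {C : Set P} (hC : C ∈ Θ) :
    ∃ r, ¬ r ≤ q ∧ UniformlyBelow Θ r p ∧ ∃ c ∈ C, UniformlyBelow Θ r c := by
  obtain ⟨c, hc, g, hgc, hgp, hgq⟩ : ∃ c ∈ C, ∃ g ≤ c, g ≤ p ∧ ¬ g ≤ q := by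
    by_contra! hno
    exact h (hadm.le_of_forall_le hdir hC hno)
  obtain ⟨r, hrg, hrq⟩ := hadm.exists_uniformlyBelow_not_le hgq
  exact ⟨r, hrq, hrg.le_right hgp, c, hc, hrg.le_right hgc⟩

/-- The spectrum of the regularisation separates the order. -/
theorem IsAdmissible.exists_spectrum_mem_not_mem (hadm : IsAdmissible Θ)
    (hdir : IsDirectedFamily Θ) (hcount : HasCountableBase Θ) {p q : P} (h : ¬ p ≤ q) :
    ∃ R : Spectrum (regularisation Θ), p ∈ R.carrier ∧ q ∉ R.carrier := by
  obtain ⟨C, hC, -, cof⟩ := hdir.exists_seq hcount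
  have hle := hadm.le_of_uniformlyBelow
  choose g hgq hgp hgC using fun (n : ℕ) (r : {r : P // ¬ r ≤ q}) =>
    hadm.exists_uniformlyBelow_mem_not_le hdir r.2 (hC n)
  let r : ℕ → {r : P // ¬ r ≤ q} := fun n => Nat.rec ⟨p, h⟩ (fun n r => ⟨g n r, hgq n r⟩) n
  have hr : ∀ n, UniformlyBelow Θ (r (n + 1)).1 (r n).1 := fun n => hgp n (r n)
  have hanti : Antitone fun n => (r n).1 := antitone_nat_of_succ_le fun n => hle _ _ (hr n)
  -- The sequence starts at `r 0 = p`, and `r (n + 1)` is uniformly below both `r n` and a member of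
  -- `C n`; so the filter it generates is Cauchy and contains `p`.
  refine ⟨⟨{s | ∃ n, UniformlyBelow Θ (r n).1 s},
    (hadm.isPoint_regularisation_iff hdir _).2 ⟨?_, ?_, ?_⟩⟩, ⟨1, hr 0⟩,
    fun ⟨n, hn⟩ => (r n).2 (hle _ _ hn)⟩
  · rintro s ⟨n, hn⟩
    refine isUpperSet_nearElements (hle _ _ hn) ?_
    by_contra hnear
    exact (r n).2 (hadm.le_of_not_mem_nearElements hdir.nonempty hnear q)
  · intro D hD
    obtain ⟨n, hn⟩ := cof D hD
    obtain ⟨c, hc, hrc⟩ := hgC n (r n)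
    obtain ⟨d, hd, hcd⟩ := hn c hc
    exact ⟨d, hd, n + 1, hrc.le_right hcd⟩
  · refine isFilterFor_of_forall_exists ?_ fun s ⟨n, hn⟩ t hst =>
      ⟨n, hn.le_right (hle _ _ hst)⟩
    intro F hF hFR
    choose! k hk using hFR
    obtain ⟨N, hN⟩ := (hF.image k).bddAbove
    exact ⟨(r N).1, ⟨N + 1, hr N⟩, fun f hf =>
      (hk hf).le_left (hanti (hN (Set.mem_image_of_mem k hf)))⟩

theorem IsAdmissible.le_iff_specOpen_subset (hadm : IsAdmissible Θ) (hdir : IsDirectedFamily Θ)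
    (hcount : HasCountableBase Θ) (p q : P) :
    p ≤ q ↔ specOpen (regularisation Θ) p ⊆ specOpen (regularisation Θ) q := by
  refine ⟨fun h R hR => R.isPoint.2.2 h hR, fun h => ?_⟩
  by_contra hpq
  obtain ⟨R, hp, hq⟩ := hadm.exists_spectrum_mem_not_mem hdir hcount hpq
  exact hq (h hp)

/-- The order isomorphism between `P` and the basis of a spectrum that separates the order. -/
noncomputable def specBasisOrderIso (Ξ : Set (Set P))
    (h : ∀ p q : P, p ≤ q ↔ specOpen Ξ p ⊆ specOpen Ξ q) : P ≃o specBasis Ξ where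
  toEquiv := Equiv.ofBijective (toSpecBasis Ξ)
    ⟨fun p q hpq => by
      have hpq : specOpen Ξ p = specOpen Ξ q := congrArg Subtype.val hpq
      exact le_antisymm ((h p q).2 hpq.subset) ((h q p).2 hpq.symm.subset),
      by
        rintro ⟨_, p, rfl⟩
        exact ⟨p, rfl⟩⟩
  map_rel_iff' := (h _ _).symm

theorem IsAdmissible.isCompleteFamily_specCovers (hadm : IsAdmissible Θ)
    (hdir : IsDirectedFamily Θ) (hcount : HasCountableBase Θ) :
    IsCompleteFamily (specCovers (regularisation Θ) Θ) := by
  have hsub := hadm.le_iff_specOpen_subset hdir hcount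
  let e := specBasisOrderIso (regularisation Θ) hsub
  intro R' hcau hfil
  obtain ⟨R, rfl⟩ : ∃ R, e '' R = R' := Set.image_surjective.2 e.surjective R'
  have hfil : IsFilterFor (UniformlyBelow Θ) R :=
    (isFilterFor_image_iff e.toEquiv fun _ _ => uniformlyBelow_image_iff e).1 hfil
  have hcau : IsCauchy Θ R := by
    intro C hC
    obtain ⟨_, ⟨c, hc, rfl⟩, d, hd, hdc⟩ := hcau _ (Set.mem_image_of_mem _ hC)
    exact ⟨c, hc, e.injective hdc ▸ hd⟩
  by_cases hn : R ⊆ nearElements Θ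
  · refine ⟨⟨R, (hadm.isPoint_regularisation_iff hdir R).2 ⟨hn, hcau, hfil⟩⟩, ?_⟩
    rintro ⟨_, p, rfl⟩ hp
    exact ⟨p, hp, rfl⟩
  -- Degenerate case: `z` is the least element, so `R` is all of `P` and any point will do. One
  -- exists, since otherwise `∅ ∈ Θ`, which no Cauchy set allows.
  · obtain ⟨z, hzR, hz⟩ := Set.not_subset.1 hn
    have hbot := hadm.le_of_not_mem_nearElements hdir.nonempty hz
    obtain ⟨p, hp⟩ : ∃ p, ¬ p ≤ z := by
      by_contra! hall
      have hnone : ∀ p : P, p ∉ nearElements Θ := fun p hp =>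
        hz (isUpperSet_nearElements (hall p) hp)
      obtain ⟨c, hc, -⟩ := hcau ∅ (hadm.empty_mem hdir.nonempty hnone)
      exact hc
    obtain ⟨x, -⟩ := hadm.exists_spectrum_mem_not_mem hdir hcount hp
    refine ⟨x, ?_⟩
    rintro ⟨_, q, rfl⟩ -
    exact ⟨q, hfil.isUpperSet (hbot q) hzR, rfl⟩

theorem IsAdmissible.exists_uniformlyBelow_mem (hadm : IsAdmissible Θ)
    (hdir : IsDirectedFamily Θ) (R : Spectrum (regularisation Θ)) {p : P} (hp : p ∈ R.carrier) :
    ∃ q ∈ R.carrier, UniformlyBelow Θ q p :=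
  (((hadm.isPoint_regularisation_iff hdir _).1 R.isPoint).2.2).exists_rel hp

theorem IsAdmissible.forall_starOf_of_mem (hadm : IsAdmissible Θ) (hdir : IsDirectedFamily Θ)
    (R : Spectrum (regularisation Θ)) {C : Set P} {p q c : P} (h : ∀ c ∈ starOf Θ C p, c ≤ q)
    (hc : c ∈ C) (hcR : c ∈ R.carrier) (hpR : p ∈ R.carrier) : c ≤ q :=
  h c ⟨hc, (hadm.isNear_pair_regularisation_iff hdir).1 (R.isPoint.isNear_pair hcR hpR)⟩

theorem IsAdmissible.isLocallyUniform_specCovers (hadm : IsAdmissible Θ)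
    (hdir : IsDirectedFamily Θ) : IsLocallyUniform (specCovers (regularisation Θ) Θ) := by
  rintro R _ ⟨C, hC, rfl⟩
  obtain ⟨c, hc, hcR⟩ := R.isPoint.2.1 C (subset_regularisation hC)
  -- Two descents inside `R` match the two stars: sets of `D` at `R` fall below `d`, and sets of `D`
  -- meeting those fall below `c`.
  obtain ⟨d, hdR, E, hE, hEc⟩ := hadm.exists_uniformlyBelow_mem hdir R hcR
  obtain ⟨e, heR, E', hE', hEd⟩ := hadm.exists_uniformlyBelow_mem hdir R hdR
  obtain ⟨D, hD, hDE, hDE'⟩ := hdir.exists_pair hE hE'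
  refine ⟨_, Set.mem_image_of_mem _ hD, ?_⟩
  rintro T ⟨_, ⟨f, hf, rfl⟩, ⟨S, hfS, _, ⟨g, hg, rfl⟩, hgR, hgS⟩, hfT⟩
  have hgd : g ≤ d := hadm.forall_starOf_of_mem hdir R
    (forall_starOf_le_of_refines hDE' hEd) hg hgR heR
  have hfc : f ≤ c := hadm.forall_starOf_of_mem hdir S
    (forall_starOf_le_of_refines hDE hEc) hf hfS (S.isPoint.2.2 hgd hgS)
  exact ⟨_, ⟨c, hc, rfl⟩, hcR, T.isPoint.2.2 hfc hfT⟩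

theorem IsAdmissible.isCompatible_specCovers (hadm : IsAdmissible Θ)
    (hdir : IsDirectedFamily Θ) : IsCompatible (specCovers (regularisation Θ) Θ) := by
  intro R
  refine (isTopologicalBasis_specBasis
    (hadm.isDirectedFamily_regularisation hdir)).nhds_hasBasis.to_hasBasis ?_ ?_
  · rintro _ ⟨⟨p, rfl⟩, hp⟩
    obtain ⟨r, hr, C, hC, hCp⟩ := hadm.exists_uniformlyBelow_mem hdir R hp
    refine ⟨_, Set.mem_image_of_mem _ hC, ?_⟩
    rintro S ⟨_, ⟨c, hc, rfl⟩, hcR, hcS⟩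
    exact S.isPoint.2.2 (hadm.forall_starOf_of_mem hdir R hCp hc hcR hr) hcS
  · rintro _ ⟨C, hC, rfl⟩
    obtain ⟨c, hc, hcR⟩ := R.isPoint.2.1 C (subset_regularisation hC)
    exact ⟨_, ⟨⟨c, rfl⟩, hcR⟩, fun S hS => ⟨_, ⟨c, hc, rfl⟩, hcR, hS⟩⟩

/-- A countable admissible filter is represented by covers of its spectrum. -/
theorem IsCountableAdmissibleFilter.isConcreteCoverFilter (h : IsCountableAdmissibleFilter Θ) :
    IsConcreteCoverFilter (Spectrum (regularisation Θ)) (specBasis (regularisation Θ))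
      (specCovers (regularisation Θ) Θ) := by
  obtain ⟨hfil, hadm, hcount⟩ := h
  have hdir := hfil.isDirectedFamily
  let e := specBasisOrderIso (regularisation Θ) (hadm.le_iff_specOpen_subset hdir hcount)
  exact
    { completelyMetrisable :=
        hadm.isCompletelyMetrizableSpace_spectrum_regularisation hdir hcount
      isBasis := isTopologicalBasis_specBasis (hadm.isDirectedFamily_regularisation hdir)
      covers := by
        rintro _ ⟨C, hC, rfl⟩ R
        obtain ⟨c, hc, hcR⟩ := R.isPoint.2.1 C (subset_regularisation hC)
        exact ⟨_, ⟨c, hc, rfl⟩, hcR⟩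
      isFilter := (isFilterFamily_image_iff e).2 hfil
      hasCountableBase := hcount.image e
      complete := hadm.isCompleteFamily_specCovers hdir hcount
      locallyUniform := hadm.isLocallyUniform_specCovers hdir
      compatible := hadm.isCompatible_specCovers hdir }

theorem IsCountableAdmissibleFilter.countable_iff (h : IsCountableAdmissibleFilter Θ) :
    Θ.Countable ↔ (specCovers (regularisation Θ) Θ).Countable := by
  let e := specBasisOrderIso (regularisation Θ)
    (h.isAdmissible.le_iff_specOpen_subset h.isFilter.isDirectedFamily h.hasCountableBase)
  exact ⟨fun h => h.image _, Set.countable_of_injective_of_countable_image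
    e.injective.image_injective.injOn⟩

end Abstract

end NearnessPoset

/-! ### Duality: from covers back to posets -/

namespace NearnessPoset

section Covers

variable {X : Type v} {B : Set (Set X)} {Θ : Set (Set B)}

theorem ConsistsOfCovers.isCauchy (hcov : ConsistsOfCovers Θ) (x : X) :
    IsCauchy Θ (elementsAt B x) :=
  fun C hC => let ⟨c, hc, hx⟩ := hcov C hC x; ⟨c, hc, hx⟩

/-- If `p` and `q` were disjoint, the non-empty members of a common refinement of `D ∪ {p}` and `D ∪
{q}` would lie below `D`. A point of `X` is needed so that `D` has an element to put above an empty
member. -/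
theorem nonempty_inter_of_isNear_pair [Nonempty X] (hcov : ConsistsOfCovers Θ)
    (hdir : IsDirectedFamily Θ) {p q : B} (h : IsNear (upClosure Θ) {p, q}) :
    ((p : Set X) ∩ q).Nonempty := by
  obtain ⟨D, hD, h⟩ := h
  obtain ⟨A, hA, hAp⟩ := h p (by simp)
  obtain ⟨A', hA', hAq⟩ := h q (by simp)
  obtain ⟨C, hC, hCA, hCA'⟩ := hdir.exists_pair hA hA'
  by_contra hno
  have key : ∀ c ∈ C, (c : Set X).Nonempty → ∃ d ∈ D, c ≤ d := by
    rintro c hc ⟨y, hy⟩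
    obtain ⟨a, ha | rfl, hca⟩ := (hCA.trans_le hAp) c hc
    · exact ⟨a, ha, hca⟩
    obtain ⟨b, hb | rfl, hcb⟩ := (hCA'.trans_le hAq) c hc
    · exact ⟨b, hb, hcb⟩
    exact absurd ⟨y, hca hy, hcb hy⟩ hno
  obtain ⟨x⟩ := ‹Nonempty X›
  obtain ⟨c₀, hc₀, hx⟩ := hcov C hC x
  obtain ⟨d₀, hd₀, -⟩ := key c₀ hc₀ ⟨x, hx⟩
  refine hD ⟨C, hC, fun c hc => ?_⟩
  rcases (c : Set X).eq_empty_or_nonempty with h0 | hne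
  · exact ⟨d₀, hd₀, fun y hy => by
      rw [h0] at hy
      exact hy.elim⟩
  · exact key c hc hne

end Covers

section Concrete

variable {X : Type v} [TopologicalSpace X] {B : Set (Set X)} {Θ : Set (Set B)}

theorem IsCompatible.exists_unionAt_subset (hcomp : IsCompatible Θ) {x : X} {U : Set X}
    (hU : IsOpen U) (hx : x ∈ U) : ∃ C ∈ Θ, unionAt C x ⊆ U :=
  (hcomp x).mem_iff.1 (hU.mem_nhds hx)

theorem isNear_of_forall_mem (hB : ∀ b ∈ B, IsOpen b) (hcov : ConsistsOfCovers Θ)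
    (hcomp : IsCompatible Θ) {x : X} {S : Set B} (hS : S ⊆ elementsAt B x) :
    IsNear (upClosure Θ) S := by
  -- No cover refines the sets missing `x`; by compatibility some cover has all its members at `x`
  -- inside `s`.
  refine ⟨{d | x ∉ (d : Set X)}, ?_, fun s hs => ?_⟩
  · rintro ⟨C, hC, h⟩
    obtain ⟨c, hc, hx⟩ := hcov C hC x
    obtain ⟨d, hd, hcd⟩ := h c hc
    exact hd (hcd hx)
  · obtain ⟨C, hC, h⟩ := hcomp.exists_unionAt_subset (hB s s.2) (hS hs)
    refine ⟨C, hC, fun c hc => ?_⟩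
    by_cases hx : x ∈ (c : Set X)
    · exact ⟨s, Or.inr rfl, fun y hy => h ⟨c, hc, hx, hy⟩⟩
    · exact ⟨c, Or.inl hx, le_rfl⟩

theorem isNear_pair_of_nonempty_inter (hB : ∀ b ∈ B, IsOpen b) (hcov : ConsistsOfCovers Θ)
    (hcomp : IsCompatible Θ) {p q : B} (h : ((p : Set X) ∩ q).Nonempty) :
    IsNear (upClosure Θ) {p, q} := by
  obtain ⟨x, hp, hq⟩ := h
  exact isNear_of_forall_mem hB hcov hcomp (x := x) (by rintro _ (rfl | rfl) <;> assumption)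

theorem le_of_uniformlyBelow_of_isCompatible (hB : ∀ b ∈ B, IsOpen b)
    (hcov : ConsistsOfCovers Θ) (hcomp : IsCompatible Θ) {p q : B}
    (h : UniformlyBelow Θ p q) : p ≤ q := by
  obtain ⟨C, hC, h⟩ := h
  intro x hx
  obtain ⟨c, hc, hxc⟩ := hcov C hC x
  exact h c ⟨hc, isNear_pair_of_nonempty_inter hB hcov hcomp ⟨x, hxc, hx⟩⟩ hxc

/-- Members of `D` near `d` meet it, so local uniformity traps them in `U`. Allowing any open `U`
lets one `d` serve finitely many basic sets at once, through their intersection. -/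
theorem exists_uniformlyBelow_of_isLocallyUniform (hcov : ConsistsOfCovers Θ)
    (hdir : IsDirectedFamily Θ) (hlu : IsLocallyUniform Θ) (hcomp : IsCompatible Θ) {x : X}
    {U : Set X} (hU : IsOpen U) (hx : x ∈ U) :
    ∃ d : B, x ∈ (d : Set X) ∧ ∀ p : B, U ⊆ p → UniformlyBelow Θ d p := by
  have : Nonempty X := ⟨x⟩
  obtain ⟨C, hC, hCU⟩ := hcomp.exists_unionAt_subset hU hx
  obtain ⟨D, hD, hDC⟩ := hlu x C hC
  obtain ⟨d, hd, hxd⟩ := hcov D hD x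
  refine ⟨d, hxd, fun p hp => ⟨D, hD, fun e he y hy => hp (hCU (hDC ⟨e, he.1, ?_, hy⟩))⟩⟩
  obtain ⟨z, hze, hzd⟩ := nonempty_inter_of_isNear_pair hcov hdir he.2
  exact ⟨z, hze, d, hd, hxd, hzd⟩

/-- Locally uniform compatible families of covers are admissible. -/
theorem isAdmissible_of_isLocallyUniform (hB : ∀ b ∈ B, IsOpen b) (hcov : ConsistsOfCovers Θ)
    (hdir : IsDirectedFamily Θ) (hlu : IsLocallyUniform Θ) (hcomp : IsCompatible Θ) :
    IsAdmissible Θ := by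
  refine fun p => ⟨fun q hq => le_of_uniformlyBelow_of_isCompatible hB hcov hcomp hq, ?_⟩
  intro u hu x hx
  obtain ⟨d, hxd, hd⟩ :=
    exists_uniformlyBelow_of_isLocallyUniform hcov hdir hlu hcomp (hB p p.2) hx
  exact hu (hd p subset_rfl) hxd

theorem isFilterFor_elementsAt (hB : ∀ b ∈ B, IsOpen b) (hcov : ConsistsOfCovers Θ)
    (hdir : IsDirectedFamily Θ) (hlu : IsLocallyUniform Θ) (hcomp : IsCompatible Θ) (x : X) :
    IsFilterFor (UniformlyBelow Θ) (elementsAt B x) := by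
  refine isFilterFor_of_forall_exists ?_ fun s hs q hsq =>
    le_of_uniformlyBelow_of_isCompatible hB hcov hcomp hsq hs
  intro F hF hFx
  obtain ⟨d, hxd, hd⟩ := exists_uniformlyBelow_of_isLocallyUniform hcov hdir hlu hcomp
    (U := ⋂ f ∈ F, (f : Set X)) (x := x) (hF.isOpen_biInter fun f _ => hB f f.2)
    (Set.mem_iInter₂.2 fun f hf => hFx hf)
  exact ⟨d, hxd, fun f hf => hd f (Set.biInter_subset_of_mem hf)⟩

theorem IsConcreteCoverFilter.isOpen (h : IsConcreteCoverFilter X B Θ) : ∀ b ∈ B, IsOpen b :=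
  fun _ hb => h.isBasis.isOpen hb

theorem IsConcreteCoverFilter.isCountableAdmissibleFilter (h : IsConcreteCoverFilter X B Θ) :
    IsCountableAdmissibleFilter Θ where
  isFilter := h.isFilter
  isAdmissible := isAdmissible_of_isLocallyUniform h.isOpen h.covers h.isFilter.isDirectedFamily
    h.locallyUniform h.compatible
  hasCountableBase := h.hasCountableBase

theorem IsConcreteCoverFilter.isPoint_elementsAt (h : IsConcreteCoverFilter X B Θ) (x : X) :
    IsPoint (regularisation Θ) (elementsAt B x) :=
  (h.isCountableAdmissibleFilter.isAdmissible.isPoint_regularisation_iff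
    h.isFilter.isDirectedFamily _).2
    ⟨fun _ hp => isNear_of_forall_mem h.isOpen h.covers h.compatible
      (Set.singleton_subset_iff.2 hp), h.covers.isCauchy x,
      isFilterFor_elementsAt h.isOpen h.covers h.isFilter.isDirectedFamily h.locallyUniform
        h.compatible x⟩

theorem IsConcreteCoverFilter.exists_elementsAt_eq (h : IsConcreteCoverFilter X B Θ)
    (R : Spectrum (regularisation Θ)) : ∃ x, elementsAt B x = R.carrier := by
  have hadm := h.isCountableAdmissibleFilter.isAdmissible
  have hdir := h.isFilter.isDirectedFamily
  obtain ⟨hn, hcau, hfil⟩ := (hadm.isPoint_regularisation_iff hdir _).1 R.isPoint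
  obtain ⟨x, hx⟩ := h.complete _ hcau hfil
  refine ⟨x, hx.antisymm fun r hr => ?_⟩
  -- A member of `C` at `x` belongs to `R`, hence is near `s` and lies inside `r`; so `x ∈ r`.
  obtain ⟨s, hs, C, hC, hsr⟩ := hfil.exists_rel hr
  obtain ⟨c, hc, hxc⟩ := h.covers C hC x
  exact hsr c ⟨hc, isNear_pair_of_isFilterFor hadm.le_of_uniformlyBelow hfil hn
    (hx hxc) hs⟩ hxc

/-- A completely metrisable space is recovered from a concrete filter of basic covers. -/
theorem IsConcreteCoverFilter.exists_homeomorph (h : IsConcreteCoverFilter X B Θ) :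
    ∃ f : X ≃ₜ Spectrum (regularisation Θ), ∀ x : X, (f x).carrier = elementsAt B x := by
  let f : X → Spectrum (regularisation Θ) := fun x => ⟨elementsAt B x, h.isPoint_elementsAt x⟩
  have hind : Topology.IsInducing f := by
    refine ⟨h.isBasis.eq_generateFrom.trans (Eq.trans ?_ induced_generateFrom_eq.symm)⟩
    congr 1
    ext U
    constructor
    · intro hU
      exact ⟨_, ⟨⟨U, hU⟩, rfl⟩, rfl⟩
    · rintro ⟨_, ⟨p, rfl⟩, rfl⟩
      exact p.2
  -- Supplies the `T₀` property, which turns the inducing map into an injective one.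
  have := h.completelyMetrisable
  have hsurj : Function.Surjective f := fun R => by
    obtain ⟨x, hx⟩ := h.exists_elementsAt_eq R
    exact ⟨x, Spectrum.ext hx⟩
  exact ⟨(Equiv.ofBijective f ⟨hind.injective, hsurj⟩).toHomeomorphOfIsInducing hind,
    fun _ => rfl⟩

end Concrete

end NearnessPoset

theorem mainTheorem4 :
    -- star-regular directed families
    (∀ (P : Type u) [PartialOrder P] (Θ : Set (Set P)),
      IsStarRegular Θ → IsDirectedFamily Θ → (∀ p q : P, UniformlyBelow Θ p q → p ≤ q) →
        (∀ R : Set P, IsPoint Θ R ↔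
          R ⊆ nearElements Θ ∧ IsCauchy Θ R ∧ IsFilterFor (UniformlyBelow Θ) R) ∧
        (HasCountableBase Θ → TopologicalSpace.IsCompletelyMetrizableSpace (Spectrum Θ))) ∧
    -- regularisation of admissible directed families
    (∀ (P : Type u) [PartialOrder P] (Θ : Set (Set P)),
      IsAdmissible Θ → IsDirectedFamily Θ →
        IsAdmissible (regularisation Θ) ∧ IsDirectedFamily (regularisation Θ) ∧
        (∀ R : Set P, IsPoint (regularisation Θ) R ↔
          R ⊆ nearElements Θ ∧ IsCauchy Θ R ∧ IsFilterFor (UniformlyBelow Θ) R) ∧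
        (HasCountableBase Θ →
          TopologicalSpace.IsCompletelyMetrizableSpace (Spectrum (regularisation Θ)))) ∧
    -- duality: from abstract to concrete
    (∀ (P : Type u) [PartialOrder P] (Θ : Set (Set P)),
      IsCountableAdmissibleFilter Θ →
        (∀ p q : P, p ≤ q ↔
          specOpen (regularisation Θ) p ⊆ specOpen (regularisation Θ) q) ∧
        IsConcreteCoverFilter (Spectrum (regularisation Θ)) (specBasis (regularisation Θ))
          (specCovers (regularisation Θ) Θ) ∧
        (Θ.Countable ↔ (specCovers (regularisation Θ) Θ).Countable)) ∧
    -- locally uniform compatible filters are admissible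
    (∀ (X : Type v) [TopologicalSpace X] (B : Set (Set X)) (Θ : Set (Set B)),
      (∀ b ∈ B, IsOpen b) → ConsistsOfCovers Θ → IsFilterFamily Θ → IsLocallyUniform Θ →
        IsCompatible Θ → IsAdmissible Θ) ∧
    -- duality: from concrete to abstract and back
    (∀ (X : Type v) [TopologicalSpace X] (B : Set (Set X)) (Θ : Set (Set B)),
      IsConcreteCoverFilter X B Θ →
        IsCountableAdmissibleFilter Θ ∧
        ∃ h : X ≃ₜ Spectrum (regularisation Θ), ∀ x : X, (h x).carrier = elementsAt B x) := by
  refine ⟨fun P _ Θ hstar hdir hle => ⟨isPoint_iff_of_isStarRegular hstar hdir hle,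
    isCompletelyMetrizableSpace_spectrum hstar hdir hle⟩, fun P _ Θ hadm hdir =>
    ⟨hadm.isAdmissible_regularisation hdir, hadm.isDirectedFamily_regularisation hdir,
      hadm.isPoint_regularisation_iff hdir,
      hadm.isCompletelyMetrizableSpace_spectrum_regularisation hdir⟩,
    fun P _ Θ h => ⟨h.isAdmissible.le_iff_specOpen_subset h.isFilter.isDirectedFamily
      h.hasCountableBase, h.isConcreteCoverFilter, h.countable_iff⟩,
    fun X _ B Θ hB hcov hfil hlu hcomp =>
      isAdmissible_of_isLocallyUniform hB hcov hfil.isDirectedFamily hlu hcomp,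
    fun X _ B Θ h => ⟨h.isCountableAdmissibleFilter, h.exists_homeomorph⟩⟩
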